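/- Let $b\ge 2$ and let $\Xi=(\bar\xi_{ij})_{i,j=1}^b$ be a random matrix with positive entries (an arbitrary joint distribution is allowed). For $s\in[0,1]$ let $m(s)$ be the $b\times b$ matrix with entries $\mathbb{E}\,\bar\xi_{ij}^{\,s}$, let $\rho(s)$ be the largest eigenvalue of $m(s)$, and put $\lambda_1=\inf_{s\in[0,1]}\rho(s)$. With $\mathbb{D}=\{s\in\mathbb{R}:\mathbb{E}\,\bar\xi_{ij}^{\,s}<\infty\ \text{for all } i,j\}$, assume that $[0,1]\subseteq\mathbb{D}$, that $0$ is an interior point of $\mathbb{D}$, and that $\mathbb{E}|\log\bar\xi_{ij}|<\infty$ and $\mathbb{E}|\bar\xi_{ij}\log\bar\xi_{ij}|<\infty$ for all $i,j$. Consider the recursive distributional equation $$1+\sum_{j=1}^b\bar\xi_{ij}Y_j\stackrel{\mathcal D}{=}Y_i,\qquad i=1,\dots,b,$$ where $\stackrel{\mathcal D}{=}$ is equality in distribution; a solution is a random vector $Y=(Y_1,\dots,Y_b)$ with finite nonnegative, mutually independent components, independent of $\Xi$, such that the equation holds for each $i$ (the random matrix being given only through its law, $\Xi$ and $Y$ may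 be realized on any probability space). If $\lambda_1<1$, then this equation has a solution. If $\lambda_1>1$, then it has no solution. -/

import Mathlib

open MeasureTheory ProbabilityTheory Set

namespace ColouredTree

section

variable {Ω : Type*} [MeasurableSpace Ω] {b : ℕ}

/-- The matrix `m(s)` with entries `𝔼 (ξ i j) ^ s`. -/
noncomputable def momentMatrix (P : Measure Ω) (ξ : Ω → Fin b → Fin b → ℝ) (s : ℝ) :
    Matrix (Fin b) (Fin b) ℝ :=
  Matrix.of fun i j => ∫ ω, ξ ω i j ^ s ∂P

/-- `ρ(s)`: the largest (real) eigenvalue of `m(s)`. -/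
noncomputable def rho (P : Measure Ω) (ξ : Ω → Fin b → Fin b → ℝ) (s : ℝ) : ℝ :=
  sSup {r : ℝ | Module.End.HasEigenvalue (Matrix.toLin' (momentMatrix P ξ s)) r}

/-- `λ₁ = inf_{s ∈ [0,1]} ρ(s)`. -/
noncomputable def lambda1 (P : Measure Ω) (ξ : Ω → Fin b → Fin b → ℝ) : ℝ :=
  sInf (rho P ξ '' Icc (0 : ℝ) 1)

/-- The set `𝔻` of real exponents `s` for which all the moments `𝔼 (ξ i j) ^ s` are finite. -/
def momentDomain (P : Measure Ω) (ξ : Ω → Fin b → Fin b → ℝ) : Set ℝ :=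
  {s : ℝ | ∀ i j, Integrable (fun ω => ξ ω i j ^ s) P}

/-- The regularity conditions on the family `ξ`. -/
structure Regular (P : Measure Ω) (ξ : Ω → Fin b → Fin b → ℝ) : Prop where
  unit_interval : Icc (0 : ℝ) 1 ⊆ momentDomain P ξ
  zero_interior : (0 : ℝ) ∈ interior (momentDomain P ξ)
  log_integrable : ∀ i j, Integrable (fun ω => Real.log (ξ ω i j)) P
  mul_log_integrable : ∀ i j, Integrable (fun ω => ξ ω i j * Real.log (ξ ω i j)) P

/-- On the probability space `(Ω', Q)`, the random vector `Y`, together with a copy `X` of the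
random matrix `ξ`, solves the recursive distributional equation
`1 + ∑ j, ξ i j * Y j =ᵈ Y i` for all `i`.  As usual for such equations (here with positive
coefficients), `Y` is a finite nonnegative vector, it is independent of the coefficients, and its
components are independent of each other. -/
structure IsRDESolution (P : Measure Ω) (ξ : Ω → Fin b → Fin b → ℝ)
    {Ω' : Type*} [MeasurableSpace Ω'] (Q : Measure Ω')
    (X : Ω' → Fin b → Fin b → ℝ) (Y : Ω' → Fin b → ℝ) : Prop where
  isProbabilityMeasure : IsProbabilityMeasure Q
  measurable_matrix : Measurable X
  measurable_vector : Measurable Y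
  identDistrib_matrix : IdentDistrib X ξ Q P
  nonneg : ∀ i, ∀ᵐ ω ∂Q, 0 ≤ Y ω i
  indep_components : iIndepFun (fun (i : Fin b) (ω : Ω') => Y ω i) Q
  indep_matrix : IndepFun Y X Q
  equation : ∀ i, IdentDistrib (fun ω => 1 + ∑ j, X ω i j * Y ω j) (fun ω => Y ω i) Q Q

end

end ColouredTree

namespace ColouredTree

/-! ### Perron theory for positive matrices -/

section Perron

variable {n : Type*} [Fintype n]

/-! Existence. If λ₁ < 1, some s in (0, 1] has ρ(s) < 1; s = 0 is excluded since ρ(0) = b. Iterating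
the equation yields, for each root type, a sum over all paths of a b-ary tree, with independent
copies of Ξ at the vertices, of the product of the weights along the path. As t ↦ t ^ s is
subadditive, a multiple v of the Perron vector with 1 + m(s) v ≤ v bounds the s-th moments of the
partial sums, so the total sums are almost surely finite (`ae_totalSum_ne_top`). One independent
tree per type makes the components independent, and grafting these trees onto a fresh root gives the
equation (`map_graft`, `totalSum_graft`).

Non-existence. For a solution Y let h_i(x) = 1 - 𝔼 exp(-e^(-x) Y_i). Then h_i is decreasing and
h_i(x) e^x is increasing, so h_i decays with local exponents in [0, 1], exactly the range in the
definition of λ₁. The equation makes h a supersolution, and since h tends to 0 it is nearly a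
supersolution of the linearized equation far out (`exists_linearized`). If λ₁ > 1, there are vectors
v(s), continuous in s, with m(s) v(s) ≥ (1 + ε) v(s) (`exists_subsolution`), so every v(s) e^(-sx)
is a strict subsolution. The test function lets s climb slowly from 0 to 1 over a long interval. A
multiple of h touches it from above inside that interval (`exists_touching`), where it is nearly
exponential on the scale of the truncated weights; comparing there is contradictory
(`not_isLaplaceProfile`). -/

theorem mulVec_pos_of_pos {A : Matrix n n ℝ} (hA : ∀ i j, 0 < A i j) {z : n → ℝ}
    (hz : ∀ i, 0 ≤ z i) (hz0 : z ≠ 0) (i : n) : 0 < A.mulVec z i := by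
  obtain ⟨j, hj⟩ := Function.ne_iff.1 hz0
  exact Finset.sum_pos' (fun k _ => mul_nonneg (hA i k).le (hz k))
    ⟨j, Finset.mem_univ j, mul_pos (hA i j) (lt_of_le_of_ne (hz j) (Ne.symm hj))⟩

/-- The Perron root as the maximum of the Collatz-Wielandt functional. -/
theorem exists_perron [Nonempty n] (A : Matrix n n ℝ) (hA : ∀ i j, 0 < A i j) :
    ∃ (r : ℝ) (x : n → ℝ), (∀ i, 0 < x i) ∧ A.mulVec x = r • x ∧
      ∀ (l : ℝ) (y : n → ℝ), y ≠ 0 → (∀ i, 0 ≤ y i) → (∀ i, l * y i ≤ A.mulVec y i) → l ≤ r := by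
  classical
  set R : ℝ := ∑ i, ∑ j, A i j with hR
  have hR0 : 0 ≤ R := Finset.sum_nonneg fun i _ => Finset.sum_nonneg fun j _ => (hA i j).le
  -- Normalizing y to the simplex makes the admissible pairs compact: summing `l * y i ≤ A.mulVec y
  -- i` over i forces `l ≤ R`.
  let S : Set (ℝ × (n → ℝ)) :=
    (Icc 0 R ×ˢ stdSimplex ℝ n) ∩ {p | ∀ i, p.1 * p.2 i ≤ A.mulVec p.2 i}
  have hmv : Continuous fun p : ℝ × (n → ℝ) => A.mulVec p.2 :=
    Continuous.matrix_mulVec continuous_const continuous_snd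
  have hS : IsCompact S := by
    refine (isCompact_Icc.prod (isCompact_stdSimplex ℝ n)).inter_right ?_
    rw [ofPred_forall]
    exact isClosed_iInter fun i => isClosed_le (by fun_prop) ((continuous_apply i).comp hmv)
  have hbd : ∀ (l : ℝ) (y : n → ℝ), 0 ≤ l → y ∈ stdSimplex ℝ n →
      (∀ i, l * y i ≤ A.mulVec y i) → (l, y) ∈ S := by
    intro l y hl hy h
    refine ⟨⟨⟨hl, ?_⟩, hy⟩, h⟩
    calc l = ∑ i, l * y i := by rw [← Finset.mul_sum, hy.2, mul_one]
      _ ≤ ∑ i, A.mulVec y i := Finset.sum_le_sum fun i _ => h i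
      _ ≤ R := by
        refine Finset.sum_le_sum fun i _ => Finset.sum_le_sum fun j _ => ?_
        have : y j ≤ 1 := by
          rw [← hy.2]
          exact Finset.single_le_sum (fun k _ => hy.1 k) (Finset.mem_univ j)
        exact mul_le_of_le_one_right (hA i j).le this
  obtain ⟨i0⟩ := ‹Nonempty n›
  have hne : S.Nonempty := by
    refine ⟨(0, Pi.single i0 1), hbd _ _ le_rfl (single_mem_stdSimplex ℝ i0) fun i => ?_⟩
    rw [zero_mul]
    refine Finset.sum_nonneg fun j _ => mul_nonneg (hA i j).le ?_
    exact (single_mem_stdSimplex ℝ i0).1 j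
  obtain ⟨⟨r, x⟩, hrx, hmax⟩ := hS.exists_isMaxOn hne continuous_fst.continuousOn
  have hr0 : 0 ≤ r := hrx.1.1.1
  have hkey : ∀ (l : ℝ) (y : n → ℝ), y ≠ 0 → (∀ i, 0 ≤ y i) →
      (∀ i, l * y i ≤ A.mulVec y i) → l ≤ r := by
    intro l y hy0 hy h
    rcases le_total l 0 with hl | hl
    · exact hl.trans hr0
    have hs : 0 < ∑ i, y i := by
      obtain ⟨j, hj⟩ := Function.ne_iff.1 hy0
      exact Finset.sum_pos' (fun k _ => hy k)
        ⟨j, Finset.mem_univ j, lt_of_le_of_ne (hy j) (Ne.symm hj)⟩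
    refine hmax (hbd l ((∑ i, y i)⁻¹ • y) hl ⟨fun i => ?_, ?_⟩ fun i => ?_)
    · exact mul_nonneg (inv_nonneg.2 hs.le) (hy i)
    · simp only [Pi.smul_apply, smul_eq_mul]
      rw [← Finset.mul_sum, inv_mul_cancel₀ hs.ne']
    · rw [Matrix.mulVec_smul]
      simp only [Pi.smul_apply, smul_eq_mul]
      rw [mul_left_comm]
      exact mul_le_mul_of_nonneg_left (h i) (inv_nonneg.2 hs.le)
  have hx0 : ∀ i, 0 ≤ x i := hrx.1.2.1
  have hxne : x ≠ 0 := by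
    rintro rfl
    have := hrx.1.2.2
    simp at this
  have hAx : ∀ i, 0 < A.mulVec x i := mulVec_pos_of_pos hA hx0 hxne
  have heq : A.mulVec x = r • x := by
    -- Otherwise A x - r x is nonnegative and nonzero, so A maps it to a strictly positive vector,
    -- and A x is admissible for some r + ε.
    by_contra hcon
    set z : n → ℝ := A.mulVec x - r • x with hz
    have hz0 : ∀ i, 0 ≤ z i := fun i => by
      have := hrx.2 i
      simp only [hz, Pi.sub_apply, Pi.smul_apply, smul_eq_mul]
      exact sub_nonneg.2 this
    have hAz : ∀ i, 0 < A.mulVec z i := mulVec_pos_of_pos hA hz0 (sub_ne_zero.2 hcon)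
    have hfin : ∃ ε > 0, ∀ i, ε * A.mulVec x i ≤ A.mulVec z i := by
      obtain ⟨k, -, hk⟩ := Finset.exists_min_image Finset.univ
        (fun i => A.mulVec z i / A.mulVec x i) ⟨i0, Finset.mem_univ _⟩
      refine ⟨_, div_pos (hAz k) (hAx k), fun i => ?_⟩
      rw [← le_div_iff₀ (hAx i)]
      exact hk i (Finset.mem_univ i)
    obtain ⟨ε, hε, h⟩ := hfin
    have := hkey (r + ε) (A.mulVec x) (fun h0 => by have := hAx i0; simp [h0] at this)
      (fun i => (hAx i).le) fun i => by
        have h1 := h i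
        have h2 : A.mulVec z i = A.mulVec (A.mulVec x) i - r * A.mulVec x i := by
          rw [hz, Matrix.mulVec_sub, Matrix.mulVec_smul]; simp
        linarith
    linarith
  refine ⟨r, x, fun i => ?_, heq, hkey⟩
  have h1 := hAx i
  rw [heq] at h1
  exact pos_of_mul_pos_right h1 hr0

/-- The largest real eigenvalue of a positive matrix has a positive eigenvector. -/
theorem exists_pos_eigenvector_sSup [DecidableEq n] [Nonempty n] (A : Matrix n n ℝ)
    (hA : ∀ i j, 0 < A i j) :
    ∃ x : n → ℝ, (∀ i, 0 < x i) ∧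
      A.mulVec x = sSup {r : ℝ | Module.End.HasEigenvalue (Matrix.toLin' A) r} • x := by
  obtain ⟨r, x, hx, hAx, hmax⟩ := exists_perron A hA
  refine ⟨x, hx, ?_⟩
  have hr : IsGreatest {r : ℝ | Module.End.HasEigenvalue (Matrix.toLin' A) r} r := by
    constructor
    · refine Module.End.hasEigenvalue_of_hasEigenvector (x := x)
        ⟨Module.End.mem_eigenspace_iff.2 (by simpa using hAx), fun h0 => ?_⟩
      obtain ⟨i0⟩ := ‹Nonempty n›
      have := hx i0
      simp [h0] at this
    · intro l hl
      obtain ⟨y, hy⟩ := hl.exists_hasEigenvector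
      have hy1 : A.mulVec y = l • y := by simpa using hy.apply_eq_smul
      -- By the triangle inequality, the entrywise absolute value of an eigenvector for l is
      -- admissible for |l|.
      refine (le_abs_self l).trans (hmax |l| (fun i => |y i|) (fun h0 => hy.2 ?_)
        (fun i => abs_nonneg _) fun i => ?_)
      · ext i
        simpa using congrFun h0 i
      · rw [← abs_mul]
        have : l * y i = A.mulVec y i := by rw [hy1]; rfl
        rw [this]
        refine (Finset.abs_sum_le_sum_abs _ _).trans (le_of_eq ?_)
        refine Finset.sum_congr rfl fun j _ => ?_
        rw [abs_mul, abs_of_pos (hA i j)]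
  rw [hr.csSup_eq, hAx]

end Perron

/-! ### Perron roots of the moment matrices -/

section Moments

variable {Ω : Type*} [MeasurableSpace Ω] {b : ℕ} {P : Measure Ω} [IsProbabilityMeasure P]
  {ξ : Ω → Fin b → Fin b → ℝ}

theorem momentMatrix_pos (hpos : ∀ i j, ∀ᵐ ω ∂P, 0 < ξ ω i j) {s : ℝ}
    (hs : s ∈ momentDomain P ξ) (i j : Fin b) : 0 < momentMatrix P ξ s i j := by
  have h : ∀ᵐ ω ∂P, 0 < ξ ω i j ^ s := (hpos i j).mono fun ω h => Real.rpow_pos_of_pos h s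
  refine (integral_pos_iff_support_of_nonneg_ae (h.mono fun ω h => h.le) (hs i j)).2 ?_
  have : P (Function.support fun ω => ξ ω i j ^ s) = P univ := by
    refine measure_congr (h.mono fun ω h => ?_)
    exact propext ⟨fun _ => trivial, fun _ => h.ne'⟩
  rw [this, measure_univ]
  exact one_pos

theorem exists_pos_eigenvector_rho (hb : 0 < b) (hpos : ∀ i j, ∀ᵐ ω ∂P, 0 < ξ ω i j) {s : ℝ}
    (hs : s ∈ momentDomain P ξ) :
    ∃ x : Fin b → ℝ, (∀ i, 0 < x i) ∧ (momentMatrix P ξ s).mulVec x = rho P ξ s • x :=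
  haveI : Nonempty (Fin b) := ⟨⟨0, hb⟩⟩
  exists_pos_eigenvector_sSup _ (momentMatrix_pos hpos hs)

theorem rho_pos (hb : 0 < b) (hpos : ∀ i j, ∀ᵐ ω ∂P, 0 < ξ ω i j) {s : ℝ}
    (hs : s ∈ momentDomain P ξ) : 0 < rho P ξ s := by
  obtain ⟨x, hx, h⟩ := exists_pos_eigenvector_rho hb hpos hs
  have h1 : 0 < (momentMatrix P ξ s).mulVec x ⟨0, hb⟩ :=
    mulVec_pos_of_pos (momentMatrix_pos hpos hs) (fun i => (hx i).le)
      (fun h0 => by have := hx ⟨0, hb⟩; simp [h0] at this) _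
  rw [h] at h1
  exact pos_of_mul_pos_left h1 (hx _).le

theorem lambda1_le_rho (hb : 0 < b) (hpos : ∀ i j, ∀ᵐ ω ∂P, 0 < ξ ω i j)
    (hD : Icc (0 : ℝ) 1 ⊆ momentDomain P ξ) {s : ℝ} (hs : s ∈ Icc (0 : ℝ) 1) :
    lambda1 P ξ ≤ rho P ξ s :=
  csInf_le ⟨0, by rintro _ ⟨u, hu, rfl⟩; exact (rho_pos hb hpos (hD hu)).le⟩ ⟨s, hs, rfl⟩

end Moments

/-! ### Sums over weighted paths in a random tree -/

section Tree

open scoped ENNReal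

variable {b : ℕ}

/-- The map which glues a root mark and `b` marked trees to a marked tree. -/
def graft {E : Type*} (z : E × (Fin b → List (Fin b) → E)) : List (Fin b) → E
  | [] => z.1
  | j :: l => z.2 j l

variable {E : Type*} [MeasurableSpace E]

theorem measurable_graft :
    Measurable (graft : E × (Fin b → List (Fin b) → E) → List (Fin b) → E) := by
  refine measurable_pi_iff.2 fun l => ?_
  cases l with
  | nil => exact measurable_fst
  | cons j l => exact (measurable_pi_apply l).comp ((measurable_pi_apply j).comp measurable_snd)

/-- The law of the tree whose vertices carry independent marks of law `μ`. -/
noncomputable abbrev treeLaw (b : ℕ) (μ : Measure E) [IsProbabilityMeasure μ] :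
    Measure (List (Fin b) → E) :=
  Measure.infinitePi fun _ => μ

variable (μ : Measure E) [IsProbabilityMeasure μ]

/-- A product measure is determined by finite boxes. Sorting the finitely many constrained words by
their first letter (or its absence) splits a box into a root factor and one box per subtree. -/
theorem map_graft :
    (μ.prod (Measure.pi fun _ : Fin b => treeLaw b μ)).map graft = treeLaw b μ := by
  classical
  refine Measure.eq_infinitePi _ fun s t ht => ?_
  have hpre : graft ⁻¹' (Set.pi (s : Set (List (Fin b))) t) =
      (if [] ∈ s then t [] else univ) ×ˢ Set.pi univ fun j : Fin b =>
        Set.pi ((s.preimage (List.cons j) (List.cons_injective.injOn) : Finset (List (Fin b))) :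
          Set (List (Fin b))) fun l => t (j :: l) := by
    ext z
    simp only [mem_preimage, Set.mem_pi, SetLike.mem_coe, mem_prod, Finset.mem_preimage, mem_univ,
      true_implies]
    constructor
    · intro h
      refine ⟨?_, fun j l hl => h _ hl⟩
      split_ifs with h0
      · exact h _ h0
      · trivial
    · rintro ⟨h0, h1⟩ l hl
      cases l with
      | nil => rwa [if_pos hl] at h0
      | cons j l => exact h1 j l hl
  rw [Measure.map_apply measurable_graft
    (MeasurableSet.pi s.countable_toSet fun i _ => ht i), hpre,
    Measure.prod_prod, Measure.pi_pi]
  have h1 : ∀ j : Fin b, treeLaw b μ (Set.pi ((s.preimage (List.cons j)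
      (List.cons_injective.injOn) : Finset (List (Fin b))) : Set (List (Fin b)))
        fun l => t (j :: l)) = ∏ l ∈ s with l.head? = some j, μ (t l) := by
    intro j
    rw [treeLaw, Measure.infinitePi_pi _ fun l _ => ht _,
      Finset.prod_preimage' (List.cons j) s _ fun l => μ (t l)]
    refine Finset.prod_congr (Finset.filter_congr fun l _ => ?_) fun _ _ => rfl
    cases l <;> simp [eq_comm]
  have h0 : μ (if [] ∈ s then t [] else univ) = ∏ l ∈ s with l.head? = none, μ (t l) := by
    split_ifs with h
    · have : {l ∈ s | l.head? = none} = {[]} := by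
        ext l
        cases l <;> simp [h]
      rw [this, Finset.prod_singleton]
    · have : {l ∈ s | l.head? = none} = ∅ := by
        ext l
        cases l <;> simp [h]
      rw [this, Finset.prod_empty, measure_univ]
  rw [h0, Finset.prod_congr rfl fun j _ => h1 j, ← Finset.prod_fiberwise s List.head?,
    Fintype.prod_option]

theorem measurePreserving_graft : MeasurePreserving graft
    (μ.prod (Measure.pi fun _ : Fin b => treeLaw b μ)) (treeLaw b μ) :=
  ⟨measurable_graft, map_graft μ⟩

/-- The sum, over the paths of length less than `n` from a root of type `i`, of the products of
the weights along the path. -/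
noncomputable def treeSum : ℕ → Fin b → (List (Fin b) → Fin b → Fin b → ℝ) → ℝ≥0∞
  | 0, _, _ => 0
  | n + 1, i, x => 1 + ∑ j, ENNReal.ofReal (x [] i j) * treeSum n j fun l => x (j :: l)

/-- The sum, over the paths from a root of type `i`, of the products of the weights along the
path. -/
noncomputable def totalSum (i : Fin b) (x : List (Fin b) → Fin b → Fin b → ℝ) : ℝ≥0∞ :=
  ⨆ n, treeSum n i x

theorem measurable_treeSum (n : ℕ) (i : Fin b) : Measurable (treeSum n i) := by
  induction n generalizing i with
  | zero => exact measurable_const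
  | succ n ih =>
    have h : ∀ j, Measurable fun x : List (Fin b) → Fin b → Fin b → ℝ =>
        treeSum n j fun l => x (j :: l) := fun j =>
      (ih j).comp (measurable_pi_iff.2 fun l => measurable_pi_apply _)
    change Measurable fun x : List (Fin b) → Fin b → Fin b → ℝ =>
      1 + ∑ j, ENNReal.ofReal (x [] i j) * treeSum n j fun l => x (j :: l)
    fun_prop

theorem measurable_totalSum (i : Fin b) : Measurable (totalSum i) :=
  Measurable.iSup fun n => measurable_treeSum n i

theorem monotone_treeSum (i : Fin b) (x : List (Fin b) → Fin b → Fin b → ℝ) :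
    Monotone fun n => treeSum n i x := by
  refine monotone_nat_of_le_succ fun n => ?_
  induction n generalizing i x with
  | zero => exact zero_le
  | succ n ih =>
    exact add_le_add le_rfl (Finset.sum_le_sum fun j _ => mul_le_mul_right (ih _ _) _)

theorem totalSum_graft (i : Fin b)
    (z : (Fin b → Fin b → ℝ) × (Fin b → List (Fin b) → Fin b → Fin b → ℝ)) :
    totalSum i (graft z) = 1 + ∑ j, ENNReal.ofReal (z.1 i j) * totalSum j (z.2 j) := by
  have h : ∀ n, treeSum (n + 1) i (graft z) =
      1 + ∑ j, ENNReal.ofReal (z.1 i j) * treeSum n j (z.2 j) := fun n => rfl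
  rw [totalSum, ← (monotone_treeSum i (graft z)).iSup_nat_add 1]
  simp only [h, totalSum, ENNReal.mul_iSup]
  rw [ENNReal.finsetSum_iSup_of_monotone
    (f := fun j n => ENNReal.ofReal (z.1 i j) * treeSum n j (z.2 j)) fun j m n hmn =>
    mul_le_mul_right (monotone_treeSum j (z.2 j) hmn) _, ENNReal.add_iSup]

theorem rpow_sum_le_sum_rpow {ι : Type*} (t : Finset ι) (f : ι → ℝ≥0∞) {s : ℝ} (hs : 0 < s)
    (hs1 : s ≤ 1) : (∑ j ∈ t, f j) ^ s ≤ ∑ j ∈ t, f j ^ s := by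
  classical
  induction t using Finset.induction_on with
  | empty => simp [hs]
  | insert a t ha ih =>
    rw [Finset.sum_insert ha, Finset.sum_insert ha]
    exact (ENNReal.rpow_add_le_add_rpow _ _ hs.le hs1).trans (add_le_add le_rfl ih)

/-- Induction on the depth: subadditivity of t ↦ t ^ s moves the power inside the sums, and the root
mark is independent of the subtrees, so each expectation factors. -/
theorem lintegral_treeSum_rpow_le (μ : Measure (Fin b → Fin b → ℝ)) [IsProbabilityMeasure μ]
    {s : ℝ} (hs : 0 < s) (hs1 : s ≤ 1) {v : Fin b → ℝ≥0∞}
    (hv : ∀ i, 1 + ∑ j, (∫⁻ a, ENNReal.ofReal (a i j) ^ s ∂μ) * v j ≤ v i) (n : ℕ) (i : Fin b) :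
    ∫⁻ x, treeSum n i x ^ s ∂(treeLaw b μ) ≤ v i := by
  induction n generalizing i with
  | zero => simp [treeSum, hs]
  | succ n ih =>
    have hm : ∀ j, Measurable fun a : Fin b → Fin b → ℝ => ENNReal.ofReal (a i j) ^ s := by
      intro j
      fun_prop
    have hm' : ∀ j, Measurable fun y : Fin b → List (Fin b) → Fin b → Fin b → ℝ =>
        treeSum n j (y j) ^ s := fun j =>
      ((measurable_treeSum n j).comp (measurable_pi_apply j)).pow_const s
    rw [← (measurePreserving_graft μ).lintegral_comp
      ((measurable_treeSum (n + 1) i).pow_const s)]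
    calc ∫⁻ z, treeSum (n + 1) i (graft z) ^ s ∂(μ.prod (Measure.pi fun _ => treeLaw b μ))
        ≤ ∫⁻ z, (1 + ∑ j, ENNReal.ofReal (z.1 i j) ^ s * treeSum n j (z.2 j) ^ s)
            ∂(μ.prod (Measure.pi fun _ => treeLaw b μ)) := by
          refine lintegral_mono fun z => ?_
          refine (ENNReal.rpow_add_le_add_rpow _ _ hs.le hs1).trans ?_
          rw [ENNReal.one_rpow]
          refine add_le_add le_rfl ((rpow_sum_le_sum_rpow _ _ hs hs1).trans (le_of_eq ?_))
          exact Finset.sum_congr rfl fun j _ => ENNReal.mul_rpow_of_nonneg _ _ hs.le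
      _ = 1 + ∑ j, (∫⁻ a, ENNReal.ofReal (a i j) ^ s ∂μ) *
            ∫⁻ x, treeSum n j x ^ s ∂(treeLaw b μ) := by
          rw [lintegral_add_left measurable_const, lintegral_finsetSum]
          · simp only [lintegral_const, measure_univ, mul_one]
            congr 1
            refine Finset.sum_congr rfl fun j _ => ?_
            rw [lintegral_prod_mul (hm j).aemeasurable (hm' j).aemeasurable]
            congr 1
            exact (measurePreserving_eval (fun _ : Fin b => treeLaw b μ) j).lintegral_comp
              ((measurable_treeSum n j).pow_const s)
          · exact fun j _ => ((hm j).comp measurable_fst).mul ((hm' j).comp measurable_snd)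
      _ ≤ 1 + ∑ j, (∫⁻ a, ENNReal.ofReal (a i j) ^ s ∂μ) * v j :=
          add_le_add le_rfl (Finset.sum_le_sum fun j _ => mul_le_mul_right (ih j) _)
      _ ≤ v i := hv i

theorem ae_totalSum_ne_top (μ : Measure (Fin b → Fin b → ℝ)) [IsProbabilityMeasure μ]
    {s : ℝ} (hs : 0 < s) (hs1 : s ≤ 1) {v : Fin b → ℝ≥0∞} (hvt : ∀ i, v i ≠ ∞)
    (hv : ∀ i, 1 + ∑ j, (∫⁻ a, ENNReal.ofReal (a i j) ^ s ∂μ) * v j ≤ v i) (i : Fin b) :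
    ∀ᵐ x ∂(treeLaw b μ), totalSum i x ≠ ∞ := by
  -- The power is an order isomorphism, hence commutes with suprema; monotone convergence then
  -- carries the uniform bound to the limit.
  have h : ∀ x, totalSum i x ^ s = ⨆ n, treeSum n i x ^ s := fun x =>
    (ENNReal.orderIsoRpow s hs).map_iSup fun n => treeSum n i x
  have hint : ∫⁻ x, totalSum i x ^ s ∂(treeLaw b μ) ≠ ∞ := by
    simp only [h]
    rw [lintegral_iSup (fun n => (measurable_treeSum n i).pow_const s)
      fun m n hmn x => ENNReal.rpow_le_rpow (monotone_treeSum i x hmn) hs.le]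
    exact ne_top_of_le_ne_top (hvt i)
      (iSup_le fun n => lintegral_treeSum_rpow_le μ hs hs1 hv n i)
  refine (ae_lt_top ((measurable_totalSum i).pow_const s) hint).mono fun x hx h0 => ?_
  simp [h0, hs] at hx

end Tree

/-! ### Construction of a solution when λ₁ < 1 -/

section Existence

open scoped ENNReal

variable {Ω : Type*} [MeasurableSpace Ω] {b : ℕ} {P : Measure Ω} [IsProbabilityMeasure P]
  {ξ : Ω → Fin b → Fin b → ℝ}

theorem exists_isRDESolution_of_subinvariant (hξ : Measurable ξ)
    (hpos : ∀ i j, ∀ᵐ ω ∂P, 0 < ξ ω i j) {s : ℝ} (hs : 0 < s) (hs1 : s ≤ 1)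
    (hD : s ∈ momentDomain P ξ) {v : Fin b → ℝ} (hv0 : ∀ i, 0 ≤ v i)
    (hv : ∀ i, 1 + (momentMatrix P ξ s).mulVec v i ≤ v i) :
    ∃ (Ω' : Type) (_ : MeasurableSpace Ω') (Q : Measure Ω')
      (X : Ω' → Fin b → Fin b → ℝ) (Y : Ω' → Fin b → ℝ), IsRDESolution P ξ Q X Y := by
  set μ : Measure (Fin b → Fin b → ℝ) := P.map ξ with hμ
  have : IsProbabilityMeasure μ := Measure.isProbabilityMeasure_map hξ.aemeasurable
  set T := treeLaw b μ with hT
  set Q := μ.prod (Measure.pi fun _ : Fin b => T) with hQ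
  have hmom : ∀ i j, ∫⁻ a, ENNReal.ofReal (a i j) ^ s ∂μ =
      ENNReal.ofReal (momentMatrix P ξ s i j) := by
    intro i j
    rw [hμ, lintegral_map (by fun_prop) hξ, momentMatrix, Matrix.of_apply,
      ofReal_integral_eq_lintegral_ofReal (hD i j)
        ((hpos i j).mono fun ω h => (Real.rpow_pos_of_pos h s).le)]
    exact lintegral_congr_ae ((hpos i j).mono fun ω h => ENNReal.ofReal_rpow_of_pos h)
  have hfin : ∀ i, ∀ᵐ x ∂T, totalSum i x ≠ ∞ := by
    refine ae_totalSum_ne_top μ hs hs1 (v := fun i => ENNReal.ofReal (v i))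
      (fun i => ENNReal.ofReal_ne_top) fun i => ?_
    have hm0 : ∀ j, 0 ≤ momentMatrix P ξ s i j := fun j => (momentMatrix_pos hpos hD i j).le
    simp only [hmom, ← ENNReal.ofReal_mul (hm0 _)]
    rw [← ENNReal.ofReal_sum_of_nonneg fun j _ => mul_nonneg (hm0 j) (hv0 j),
      ← ENNReal.ofReal_one, ← ENNReal.ofReal_add zero_le_one
        (Finset.sum_nonneg fun j _ => mul_nonneg (hm0 j) (hv0 j))]
    exact ENNReal.ofReal_le_ofReal (hv i)
  have hsnd : ∀ i, MeasurePreserving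
      (fun z : (Fin b → Fin b → ℝ) × (Fin b → List (Fin b) → Fin b → Fin b → ℝ) => z.2 i) Q T :=
    fun i => (measurePreserving_eval (fun _ : Fin b => T) i).comp measurePreserving_snd
  have hfst : MeasurePreserving Prod.fst Q μ := measurePreserving_fst
  have hYm : ∀ i : Fin b, Measurable fun y : Fin b → List (Fin b) → Fin b → Fin b → ℝ =>
      (totalSum i (y i)).toReal := fun i =>
    ((measurable_totalSum i).comp (measurable_pi_apply i)).ennreal_toReal
  have hYm' : ∀ i : Fin b, Measurable
      fun z : (Fin b → Fin b → ℝ) × (Fin b → List (Fin b) → Fin b → Fin b → ℝ) =>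
        (totalSum i (z.2 i)).toReal := fun i => (hYm i).comp measurable_snd
  refine ⟨_, inferInstance, Q, Prod.fst, fun z i => (totalSum i (z.2 i)).toReal, ?_⟩
  refine ⟨inferInstance, measurable_fst, ?_, ?_, ?_, ?_, ?_, ?_⟩
  · exact measurable_pi_iff.2 hYm'
  · exact ⟨measurable_fst.aemeasurable, hξ.aemeasurable, hfst.map_eq⟩
  · exact fun i => ae_of_all _ fun z => ENNReal.toReal_nonneg
  · have h := iIndepFun_pi (μ := fun _ : Fin b => T)
      (X := fun i x => (totalSum i x).toReal)
      fun i => (measurable_totalSum i).ennreal_toReal.aemeasurable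
    rw [iIndepFun_iff_map_fun_eq_pi_map (fun i => (hYm i).aemeasurable)] at h
    rw [iIndepFun_iff_map_fun_eq_pi_map fun i => (hYm' i).aemeasurable]
    have e : ∀ {β : Type} [MeasurableSpace β]
        {f : (Fin b → List (Fin b) → Fin b → Fin b → ℝ) → β}, Measurable f →
        Q.map (fun z => f z.2) = (Measure.pi fun _ : Fin b => T).map f := by
      intro β _ f hf
      rw [← (measurePreserving_snd (μ := μ) (ν := Measure.pi fun _ : Fin b => T)).map_eq,
        Measure.map_map hf measurable_snd]
      rfl
    rw [e (f := fun y i => (totalSum i (y i)).toReal) (measurable_pi_iff.2 hYm), h]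
    congr 1
    funext i
    exact (e (hYm i)).symm
  · exact (indepFun_prod (X := id) measurable_id (measurable_pi_iff.2 hYm)).symm
  · intro i
    -- The grafted tree and the i-th subtree have the same law, so their total sums agree in
    -- distribution; almost surely the former is the left side of the equation.
    have h1 : IdentDistrib (fun z => (totalSum i (graft z)).toReal)
        (fun z => (totalSum i (z.2 i)).toReal) Q Q := by
      refine ⟨?_, (hYm' i).aemeasurable, ?_⟩
      · exact ((measurable_totalSum i).ennreal_toReal.comp measurable_graft).aemeasurable
      · have hm := (measurable_totalSum i).ennreal_toReal
        have e1 := Measure.map_map (μ := Q) hm (measurable_graft (b := b))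
        have e2 := Measure.map_map (μ := Q) hm (hsnd i).measurable
        rw [(measurePreserving_graft μ).map_eq] at e1
        rw [(hsnd i).map_eq] at e2
        exact e1.symm.trans e2
    refine IdentDistrib.trans (IdentDistrib.of_ae_eq ?_ ?_) h1
    · refine AEMeasurable.const_add (Finset.aemeasurable_fun_sum _ fun j _ => ?_) _
      exact (Measurable.mul (by fun_prop) (hYm' j)).aemeasurable
    · have hp : ∀ j, ∀ᵐ z ∂Q, 0 < z.1 i j := fun j => by
        refine hfst.quasiMeasurePreserving.ae (p := fun a => 0 < a i j) ?_
        rw [hμ]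
        refine (ae_map_iff hξ.aemeasurable ?_).2 (hpos i j)
        exact measurableSet_lt measurable_const (by fun_prop)
      have hf : ∀ j, ∀ᵐ z ∂Q, totalSum j (z.2 j) ≠ ∞ := fun j =>
        (hsnd j).quasiMeasurePreserving.ae (hfin j)
      filter_upwards [ae_all_iff.2 hp, ae_all_iff.2 hf] with z hz1 hz2
      rw [totalSum_graft, ENNReal.toReal_add ENNReal.one_ne_top
        (ENNReal.sum_ne_top.2 fun j _ => ENNReal.mul_ne_top ENNReal.ofReal_ne_top (hz2 j)),
        ENNReal.toReal_sum fun j _ => ENNReal.mul_ne_top ENNReal.ofReal_ne_top (hz2 j)]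
      simp only [ENNReal.toReal_one, ENNReal.toReal_mul, ENNReal.toReal_ofReal (hz1 _).le]

theorem exists_isRDESolution_of_lambda1_lt_one (hb : 2 ≤ b) (hξ : Measurable ξ)
    (hpos : ∀ i j, ∀ᵐ ω ∂P, 0 < ξ ω i j) (hD : Icc (0 : ℝ) 1 ⊆ momentDomain P ξ)
    (h : lambda1 P ξ < 1) :
    ∃ (Ω' : Type) (_ : MeasurableSpace Ω') (Q : Measure Ω')
      (X : Ω' → Fin b → Fin b → ℝ) (Y : Ω' → Fin b → ℝ), IsRDESolution P ξ Q X Y := by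
  have hb0 : 0 < b := by omega
  have : Nonempty (Fin b) := ⟨⟨0, hb0⟩⟩
  obtain ⟨_, ⟨s, hs, rfl⟩, hs1⟩ :=
    exists_lt_of_csInf_lt (((nonempty_Icc.2 zero_le_one).image _)) h
  obtain ⟨x, hx, hmx⟩ := exists_pos_eigenvector_rho hb0 hpos (hD hs)
  -- At s = 0 all entries of the moment matrix are 1. Evaluating the eigenvector equation at the
  -- smallest entry gives ρ(0) ≥ b ≥ 2, against ρ(s) < 1.
  have hspos : 0 < s := by
    rcases hs.1.eq_or_lt with h0 | h0
    · exfalso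
      obtain ⟨k, -, hk⟩ := Finset.exists_min_image Finset.univ x Finset.univ_nonempty
      have e := congrFun hmx k
      have e1 : (momentMatrix P ξ s).mulVec x k = ∑ j, x j := by
        simp [momentMatrix, Matrix.mulVec, dotProduct, ← h0]
      rw [e1] at e
      have h2 : ∑ j : Fin b, x k ≤ ∑ j, x j := Finset.sum_le_sum fun j _ => hk j (Finset.mem_univ j)
      simp only [Finset.sum_const, Finset.card_univ, Fintype.card_fin, nsmul_eq_mul, Pi.smul_apply,
        smul_eq_mul] at h2 e
      have h3 : (2 : ℝ) ≤ b := by exact_mod_cast hb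
      nlinarith [hx k]
    · exact h0
  obtain ⟨k, -, hk⟩ := Finset.exists_min_image Finset.univ x Finset.univ_nonempty
  -- With v = c x the requirement becomes c (1 - ρ(s)) x_i ≥ 1 for all i; it is tight at the
  -- smallest entry `x k`.
  set c : ℝ := ((1 - rho P ξ s) * x k)⁻¹ with hc
  have hd : 0 < (1 - rho P ξ s) * x k := mul_pos (sub_pos.2 hs1) (hx k)
  have hc0 : 0 < c := inv_pos.2 hd
  refine exists_isRDESolution_of_subinvariant hξ hpos hspos hs.2 (hD hs) (v := c • x)
    (fun i => mul_nonneg hc0.le (hx i).le) fun i => ?_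
  rw [Matrix.mulVec_smul, hmx]
  simp only [Pi.smul_apply, smul_eq_mul]
  have h1 : c * ((1 - rho P ξ s) * x k) = 1 := inv_mul_cancel₀ hd.ne'
  have h2 : c * ((1 - rho P ξ s) * x k) ≤ c * ((1 - rho P ξ s) * x i) := by
    have := hk i (Finset.mem_univ i)
    have := (sub_pos.2 hs1).le
    gcongr
  linarith [mul_sub c (x i) (rho P ξ s * x i)]

end Existence

theorem integrable_of_Icc_subset_momentDomain {Ω : Type*} [MeasurableSpace Ω] {b : ℕ}
    {P : Measure Ω} {ξ : Ω → Fin b → Fin b → ℝ} (hD : Icc (0 : ℝ) 1 ⊆ momentDomain P ξ)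
    (i j : Fin b) : Integrable (fun ω => ξ ω i j) P := by
  simpa using hD (right_mem_Icc.2 zero_le_one) i j

/-! ### Strict subsolutions, uniformly in the exponent, when λ₁ > 1 -/

section Subsolution

open Filter Topology

variable {Ω : Type*} [MeasurableSpace Ω] {b : ℕ} {P : Measure Ω} [IsProbabilityMeasure P]
  {ξ : Ω → Fin b → Fin b → ℝ}

theorem rpow_le_one_add {a s : ℝ} (ha : 0 < a) (hs : s ∈ Icc (0 : ℝ) 1) : a ^ s ≤ 1 + a := by
  rcases le_total a 1 with h | h
  · linarith [Real.rpow_le_one ha.le h hs.1]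
  · have := Real.rpow_le_rpow_of_exponent_le h hs.2
    rw [Real.rpow_one] at this
    linarith

theorem continuousOn_momentMatrix (hpos : ∀ i j, ∀ᵐ ω ∂P, 0 < ξ ω i j)
    (hD : Icc (0 : ℝ) 1 ⊆ momentDomain P ξ) :
    ContinuousOn (momentMatrix P ξ) (Icc 0 1) := by
  refine continuousOn_pi.2 fun i => continuousOn_pi.2 fun j => ?_
  refine continuousOn_of_dominated (bound := fun ω => 1 + ξ ω i j)
    (fun s hs => (hD hs i j).aestronglyMeasurable) (fun s hs => ?_)
    ((integrable_const 1).add (integrable_of_Icc_subset_momentDomain hD i j)) ?_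
  · filter_upwards [hpos i j] with ω h
    rw [Real.norm_of_nonneg (Real.rpow_pos_of_pos h s).le]
    exact rpow_le_one_add h hs
  · filter_upwards [hpos i j] with ω h
    exact (Real.continuous_const_rpow h.ne').continuousOn

theorem exists_bounds_momentMatrix (hpos : ∀ i j, ∀ᵐ ω ∂P, 0 < ξ ω i j)
    (hD : Icc (0 : ℝ) 1 ⊆ momentDomain P ξ) :
    ∃ c > 0, ∃ C > 0, ∀ s ∈ Icc (0 : ℝ) 1, ∀ i j,
      c ≤ momentMatrix P ξ s i j ∧ momentMatrix P ξ s i j ≤ C := by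
  have hcont := continuousOn_momentMatrix hpos hD
  have h : ∀ p : Fin b × Fin b, ∃ c > 0, ∃ C > 0, ∀ s ∈ Icc (0 : ℝ) 1,
      c ≤ momentMatrix P ξ s p.1 p.2 ∧ momentMatrix P ξ s p.1 p.2 ≤ C := by
    intro p
    have hc : ContinuousOn (fun s => momentMatrix P ξ s p.1 p.2) (Icc 0 1) :=
      continuousOn_pi.1 (continuousOn_pi.1 hcont p.1) p.2
    obtain ⟨s, hs, hmin⟩ := isCompact_Icc.exists_isMinOn (nonempty_Icc.2 zero_le_one) hc
    obtain ⟨t, ht, hmax⟩ := isCompact_Icc.exists_isMaxOn (nonempty_Icc.2 zero_le_one) hc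
    exact ⟨_, momentMatrix_pos hpos (hD hs) _ _, _, momentMatrix_pos hpos (hD ht) p.1 p.2,
      fun u hu => ⟨hmin hu, hmax hu⟩⟩
  choose c hc C hC hcC using h
  rcases isEmpty_or_nonempty (Fin b × Fin b) with he | hne
  · exact ⟨1, one_pos, 1, one_pos, fun s _ i j => he.elim (i, j)⟩
  obtain ⟨p, hp⟩ := Finite.exists_min c
  obtain ⟨q, hq⟩ := Finite.exists_max C
  exact ⟨c p, hc p, C q, hC q, fun s hs i j =>
    ⟨(hp (i, j)).trans (hcC (i, j) s hs).1, (hcC (i, j) s hs).2.trans (hq (i, j))⟩⟩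

theorem mulVec_mono {A : Matrix (Fin b) (Fin b) ℝ} (hA : ∀ i j, 0 ≤ A i j) {x y : Fin b → ℝ}
    (h : ∀ i, x i ≤ y i) (i : Fin b) : A.mulVec x i ≤ A.mulVec y i := by
  simp only [Matrix.mulVec, dotProduct]
  exact Finset.sum_le_sum fun j _ => mul_le_mul_of_nonneg_left (h j) (hA i j)

theorem pow_mulVec_mono {A : Matrix (Fin b) (Fin b) ℝ} (hA : ∀ i j, 0 ≤ A i j) {x y : Fin b → ℝ}
    (h : ∀ i, x i ≤ y i) (n : ℕ) (i : Fin b) : (A ^ n).mulVec x i ≤ (A ^ n).mulVec y i := by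
  induction n generalizing i with
  | zero => simpa using h i
  | succ n ih =>
    rw [pow_succ', ← Matrix.mulVec_mulVec, ← Matrix.mulVec_mulVec]
    exact mulVec_mono hA ih i

/-- Scale the Perron vector to have maximum 1. Since the entries of m(s) lie in [c, C] and ρ(s) ≤ b
C, its entries are at least c / (b C), uniformly in s. It lies below the vector 1, and m(s) ^ N
multiplies it by at least λ₁ ^ N. -/
theorem exists_pow_momentMatrix_ge (hb : 0 < b) (hpos : ∀ i j, ∀ᵐ ω ∂P, 0 < ξ ω i j)
    (hD : Icc (0 : ℝ) 1 ⊆ momentDomain P ξ) (h : 1 < lambda1 P ξ) :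
    ∃ N : ℕ, ∀ s ∈ Icc (0 : ℝ) 1, ∀ i, 2 ≤ ((momentMatrix P ξ s) ^ N).mulVec 1 i := by
  have : Nonempty (Fin b) := ⟨⟨0, hb⟩⟩
  obtain ⟨c, hc, C, hC, hcC⟩ := exists_bounds_momentMatrix hpos hD
  have hbC : 0 < b * C := mul_pos (Nat.cast_pos.2 hb) hC
  obtain ⟨N, hN⟩ := pow_unbounded_of_one_lt (2 * (b * C / c)) h
  refine ⟨N, fun s hs i => ?_⟩
  set m := momentMatrix P ξ s with hm
  have hm0 : ∀ i j, 0 ≤ m i j := fun i j => (momentMatrix_pos hpos (hD hs) i j).le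
  obtain ⟨x, hx, hmx⟩ := exists_pos_eigenvector_rho hb hpos (hD hs)
  have hl := lambda1_le_rho hb hpos hD hs
  set r := rho P ξ s with hr
  obtain ⟨k, hk⟩ := Finite.exists_max x
  have hpow : ∀ n : ℕ, (m ^ n).mulVec x = r ^ n • x := by
    intro n
    induction n with
    | zero => simp
    | succ n ih =>
      rw [pow_succ', ← Matrix.mulVec_mulVec, ih, Matrix.mulVec_smul, hmx, smul_smul, pow_succ]
  have hr1 : c * x k ≤ r * x i := by
    have e : m.mulVec x i = r * x i := by rw [hmx]; rfl
    rw [← e]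
    calc c * x k ≤ m i k * x k := mul_le_mul_of_nonneg_right (hcC s hs i k).1 (hx k).le
      _ ≤ ∑ j, m i j * x j := Finset.single_le_sum (f := fun j => m i j * x j)
          (fun j _ => mul_nonneg (hm0 i j) (hx j).le) (Finset.mem_univ k)
  have hr2 : r ≤ b * C := by
    have e : m.mulVec x k = r * x k := by rw [hmx]; rfl
    refine le_of_mul_le_mul_right ?_ (hx k)
    rw [← e]
    calc m.mulVec x k = ∑ j, m k j * x j := rfl
      _ ≤ ∑ j : Fin b, C * x k := Finset.sum_le_sum fun j _ =>
          mul_le_mul (hcC s hs k j).2 (hk j) (hx j).le hC.le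
      _ = b * C * x k := by simp [mul_assoc]
  have hxi : c / (b * C) ≤ (x k)⁻¹ * x i := by
    rw [div_le_iff₀ hbC, inv_mul_eq_div, div_mul_eq_mul_div, le_div_iff₀ (hx k)]
    calc c * x k ≤ r * x i := hr1
      _ ≤ b * C * x i := mul_le_mul_of_nonneg_right hr2 (hx i).le
      _ = x i * (b * C) := mul_comm _ _
  calc (2 : ℝ) = 2 * (b * C / c) * (c / (b * C)) := by field_simp
    _ ≤ r ^ N * ((x k)⁻¹ * x i) := by
        refine mul_le_mul (hN.le.trans (pow_le_pow_left₀ (by linarith) hl N)) hxi (by positivity)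
          (pow_nonneg (by linarith) N)
    _ = (m ^ N).mulVec ((x k)⁻¹ • x) i := by
        rw [Matrix.mulVec_smul, hpow]
        simp only [Pi.smul_apply, smul_eq_mul]
        ring
    _ ≤ (m ^ N).mulVec 1 i := by
        refine pow_mulVec_mono hm0 (fun j => ?_) N i
        simp only [Pi.smul_apply, smul_eq_mul, Pi.one_apply]
        rw [inv_mul_le_iff₀ (hx k), mul_one]
        exact hk j

/-- A continuous family of strict subsolutions for the moment matrices. -/
theorem exists_subsolution (hb : 0 < b) (hpos : ∀ i j, ∀ᵐ ω ∂P, 0 < ξ ω i j)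
    (hD : Icc (0 : ℝ) 1 ⊆ momentDomain P ξ) (h : 1 < lambda1 P ξ) :
    ∃ (v : ℝ → Fin b → ℝ) (ε V : ℝ), ContinuousOn v (Icc 0 1) ∧ 0 < ε ∧ ε ≤ 1 ∧
      (∀ s ∈ Icc (0 : ℝ) 1, ∀ i, 1 ≤ v s i ∧ v s i ≤ V) ∧
      ∀ s ∈ Icc (0 : ℝ) 1, ∀ i, (1 + ε) * v s i ≤ (momentMatrix P ξ s).mulVec (v s) i := by
  obtain ⟨N, hN⟩ := exists_pow_momentMatrix_ge hb hpos hD h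
  have hm0 : ∀ s ∈ Icc (0 : ℝ) 1, ∀ i j, 0 ≤ momentMatrix P ξ s i j := fun s hs i j =>
    (momentMatrix_pos hpos (hD hs) i j).le
  have hnn : ∀ s ∈ Icc (0 : ℝ) 1, ∀ n i, 0 ≤ ((momentMatrix P ξ s) ^ n).mulVec 1 i := by
    intro s hs n i
    have := pow_mulVec_mono (hm0 s hs) (x := 0) (y := 1) (fun i => zero_le_one) n i
    simpa using this
  have hN0 : N ≠ 0 := by
    rintro rfl
    have := hN 0 (left_mem_Icc.2 zero_le_one) ⟨0, hb⟩
    norm_num at this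
  -- Being polynomial in m(s), this v is visibly continuous in s. The sum telescopes to m v + 1 = v
  -- + m ^ N 1, hence m v ≥ v + 1, and ε = 1 / V turns the added 1 into a relative gain.
  set v : ℝ → Fin b → ℝ := fun s => ∑ n ∈ Finset.range N, ((momentMatrix P ξ s) ^ n).mulVec 1
    with hv
  have hvc : ContinuousOn v (Icc 0 1) := by
    have hc := continuousOn_momentMatrix hpos hD
    rw [continuousOn_iff_continuous_domRestrict] at hc ⊢
    change Continuous fun s : Icc (0 : ℝ) 1 =>
      ∑ n ∈ Finset.range N, ((momentMatrix P ξ s) ^ n).mulVec 1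
    refine continuous_finsetSum _ fun n _ => ?_
    exact Continuous.matrix_mulVec (Continuous.pow hc n) continuous_const
  have hv1 : ∀ s ∈ Icc (0 : ℝ) 1, ∀ i, 1 ≤ v s i := by
    intro s hs i
    rw [hv]
    simp only [Finset.sum_apply]
    refine le_trans ?_ (Finset.single_le_sum
      (f := fun n => ((momentMatrix P ξ s) ^ n).mulVec 1 i) (fun n _ => hnn s hs n i)
      (Finset.mem_range.2 (Nat.pos_of_ne_zero hN0)))
    simp
  obtain ⟨V, hV⟩ := isCompact_Icc.exists_bound_of_continuousOn hvc
  have hvV : ∀ s ∈ Icc (0 : ℝ) 1, ∀ i, v s i ≤ V := fun s hs i =>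
    ((le_abs_self _).trans (norm_le_pi_norm (v s) i)).trans (hV s hs)
  have hV1 : 1 ≤ V := (hv1 0 (left_mem_Icc.2 zero_le_one) ⟨0, hb⟩).trans
    (hvV 0 (left_mem_Icc.2 zero_le_one) ⟨0, hb⟩)
  have hV0 : 0 < V := by linarith
  refine ⟨v, V⁻¹, V, hvc, inv_pos.2 hV0, inv_le_one_of_one_le₀ hV1,
    fun s hs i => ⟨hv1 s hs i, hvV s hs i⟩, fun s hs i => ?_⟩
  have key : (momentMatrix P ξ s).mulVec (v s) + 1 =
      v s + ((momentMatrix P ξ s) ^ N).mulVec 1 := by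
    have e : (momentMatrix P ξ s).mulVec (v s) =
        ∑ n ∈ Finset.range N, ((momentMatrix P ξ s) ^ (n + 1)).mulVec 1 := by
      rw [hv, Matrix.mulVec_sum]
      refine Finset.sum_congr rfl fun n _ => ?_
      rw [Matrix.mulVec_mulVec, pow_succ']
    have e0 : (1 : Fin b → ℝ) = ((momentMatrix P ξ s) ^ 0).mulVec 1 := by simp
    rw [e]
    nth_rewrite 2 [e0]
    rw [← Finset.sum_range_succ' (fun n => ((momentMatrix P ξ s) ^ n).mulVec 1),
      Finset.sum_range_succ]
  have k := congrFun key i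
  simp only [Pi.add_apply, Pi.one_apply] at k
  have h2 := hN s hs i
  have h3 : V⁻¹ * v s i ≤ 1 := by
    rw [inv_mul_le_iff₀ hV0, mul_one]
    exact hvV s hs i
  linarith

/-- The moments of the weights whose logarithm is bounded by `K`. -/
noncomputable def truncMoment (P : Measure Ω) (ξ : Ω → Fin b → Fin b → ℝ) (K s : ℝ)
    (i j : Fin b) : ℝ :=
  ∫ ω, {ω | |Real.log (ξ ω i j)| ≤ K}.indicator (fun ω => ξ ω i j ^ s) ω ∂P

theorem measurableSet_abs_log_le (hξ : Measurable ξ) (K : ℝ) (i j : Fin b) :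
    MeasurableSet {ω | |Real.log (ξ ω i j)| ≤ K} := by
  refine measurableSet_le ?_ measurable_const
  have : Measurable fun ω => ξ ω i j := by fun_prop
  exact (Real.measurable_log.comp this).abs

/-- The bound 1 + ξ dominates all powers with exponent in [0, 1], so its tail integral controls the
truncation error for all s at once. -/
theorem exists_truncMoment_ge (hξ : Measurable ξ) (hpos : ∀ i j, ∀ᵐ ω ∂P, 0 < ξ ω i j)
    (hD : Icc (0 : ℝ) 1 ⊆ momentDomain P ξ) {η : ℝ} (hη : 0 < η) :
    ∃ K > 0, ∀ s ∈ Icc (0 : ℝ) 1, ∀ i j, momentMatrix P ξ s i j - η ≤ truncMoment P ξ K s i j := by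
  have hint : ∀ i j, Integrable (fun ω => 1 + ξ ω i j) P := fun i j =>
    (integrable_const 1).add (integrable_of_Icc_subset_momentDomain hD i j)
  have hlim : ∀ i j, Tendsto (fun n : ℕ => ∫ ω, {ω | |Real.log (ξ ω i j)| ≤ n}ᶜ.indicator
      (fun ω => 1 + ξ ω i j) ω ∂P) atTop (𝓝 0) := by
    intro i j
    rw [← integral_zero Ω ℝ (μ := P)]
    refine tendsto_integral_of_dominated_convergence (fun ω => 1 + ξ ω i j) (fun n => ?_)
      (hint i j) (fun n => ?_) (ae_of_all _ fun ω => ?_)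
    · exact ((hint i j).indicator
        (measurableSet_abs_log_le hξ n i j).compl).aestronglyMeasurable
    · filter_upwards [hpos i j] with ω h
      refine (norm_indicator_le_norm_self _ _).trans ?_
      rw [Real.norm_of_nonneg (by linarith)]
    · refine tendsto_const_nhds.congr' ?_
      obtain ⟨N, hN⟩ := exists_nat_ge |Real.log (ξ ω i j)|
      filter_upwards [eventually_ge_atTop N] with n hn
      rw [indicator_of_notMem]
      simp only [mem_compl_iff, mem_ofPred_eq, not_not]
      exact hN.trans (by exact_mod_cast hn)
  have hev : ∀ᶠ n : ℕ in atTop, ∀ i j, ∫ ω, {ω | |Real.log (ξ ω i j)| ≤ n}ᶜ.indicator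
      (fun ω => 1 + ξ ω i j) ω ∂P < η :=
    eventually_all.2 fun i => eventually_all.2 fun j => (hlim i j).eventually_lt_const hη
  obtain ⟨n, hn, hn0⟩ := (hev.and (eventually_gt_atTop 0)).exists
  refine ⟨n, Nat.cast_pos.2 hn0, fun s hs i j => ?_⟩
  have hmeas := measurableSet_abs_log_le hξ n i j
  rw [sub_le_iff_le_add]
  refine le_trans ?_ (add_le_add le_rfl (hn i j).le)
  rw [truncMoment, ← integral_add ((hD hs i j).indicator hmeas)
    ((hint i j).indicator hmeas.compl)]
  change ∫ ω, ξ ω i j ^ s ∂P ≤ _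
  refine integral_mono_ae (hD hs i j) (((hD hs i j).indicator hmeas).add
    ((hint i j).indicator hmeas.compl)) ?_
  filter_upwards [hpos i j] with ω h
  by_cases hω : ω ∈ {ω | |Real.log (ξ ω i j)| ≤ n}
  · simp only [indicator_of_mem hω, indicator_of_notMem (notMem_compl_iff.2 hω), add_zero, le_refl]
  · simp only [indicator_of_notMem hω, indicator_of_mem (mem_compl hω), zero_add]
    exact rpow_le_one_add h hs

theorem exists_truncated_subsolution (hb : 0 < b) (hξ : Measurable ξ)
    (hpos : ∀ i j, ∀ᵐ ω ∂P, 0 < ξ ω i j)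
    (hD : Icc (0 : ℝ) 1 ⊆ momentDomain P ξ) (h : 1 < lambda1 P ξ) :
    ∃ (v : ℝ → Fin b → ℝ) (ε K : ℝ), ContinuousOn v (Icc 0 1) ∧ 0 < ε ∧ ε ≤ 1 ∧ 0 < K ∧
      (∀ s ∈ Icc (0 : ℝ) 1, ∀ i, 1 ≤ v s i) ∧
      ∀ s ∈ Icc (0 : ℝ) 1, ∀ i, (1 + ε) * v s i ≤ ∑ j, truncMoment P ξ K s i j * v s j := by
  obtain ⟨v, ε, V, hvc, hε, hε1, hv, hmv⟩ := exists_subsolution hb hpos hD h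
  have hV : 1 ≤ V := (hv 0 (left_mem_Icc.2 zero_le_one) ⟨0, hb⟩).1.trans
    (hv 0 (left_mem_Icc.2 zero_le_one) ⟨0, hb⟩).2
  have hV0 : 0 < V := by linarith
  have hb' : (0 : ℝ) < b := Nat.cast_pos.2 hb
  -- The b entries, each weighted by at most V, lose at most ε / 2 in total, which is at most (ε /
  -- 2) v since v ≥ 1.
  obtain ⟨K, hK, ht⟩ := exists_truncMoment_ge hξ hpos hD
    (η := ε / 2 / (b * V)) (by positivity)
  refine ⟨v, ε / 2, K, hvc, by positivity, by linarith, hK, fun s hs i => (hv s hs i).1,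
    fun s hs i => ?_⟩
  have h1 := hmv s hs i
  have h2 : (momentMatrix P ξ s).mulVec (v s) i - ε / 2 ≤ ∑ j, truncMoment P ξ K s i j * v s j := by
    calc (momentMatrix P ξ s).mulVec (v s) i - ε / 2
        = ∑ j : Fin b, (momentMatrix P ξ s i j * v s j - ε / 2 / (b * V) * V) := by
          rw [Finset.sum_sub_distrib]
          simp only [Finset.sum_const, Finset.card_univ, Fintype.card_fin, nsmul_eq_mul]
          congr 1
          field_simp
      _ ≤ ∑ j, truncMoment P ξ K s i j * v s j := by
          refine Finset.sum_le_sum fun j _ => ?_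
          have h3 := ht s hs i j
          have h4 := (hv s hs j).1
          have h5 := (hv s hs j).2
          have h6 : 0 ≤ ε / 2 / (b * V) := by positivity
          have h7 := mul_le_mul_of_nonneg_right h3 (by linarith : 0 ≤ v s j)
          have h8 := mul_le_mul_of_nonneg_left h5 h6
          rw [sub_mul] at h7
          linarith
  have h3 := mul_le_mul_of_nonneg_left (hv s hs i).1 (by positivity : 0 ≤ ε / 2)
  linarith

end Subsolution

/-! ### Laplace transforms in logarithmic scale -/

section Profile

open Filter Topology

variable {Ω : Type*} [MeasurableSpace Ω] {b : ℕ}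

/-- The properties, in logarithmic scale, of the functions `t ↦ 1 - 𝔼 exp (-t * Y i)` for a
solution `Y` of the recursive distributional equation. -/
structure IsLaplaceProfile (P : Measure Ω) (ξ : Ω → Fin b → Fin b → ℝ) (h : Fin b → ℝ → ℝ) :
    Prop where
  continuous : ∀ i, Continuous (h i)
  pos : ∀ i x, 0 < h i x
  le_one : ∀ i x, h i x ≤ 1
  antitone : ∀ i, Antitone (h i)
  monotone_mul_exp : ∀ i, Monotone fun x => h i x * Real.exp x
  tendsto_zero : ∀ i, Tendsto (h i) atTop (𝓝 0)
  supersolution : ∀ i x, 1 - ∫ ω, ∏ j, (1 - h j (x - Real.log (ξ ω i j))) ∂P ≤ h i x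

theorem IsLaplaceProfile.measurable_comp {P : Measure Ω} {ξ : Ω → Fin b → Fin b → ℝ}
    {h : Fin b → ℝ → ℝ} (hh : IsLaplaceProfile P ξ h) (hξ : Measurable ξ)
    (i j : Fin b) (x : ℝ) : Measurable fun ω => h j (x - Real.log (ξ ω i j)) := by
  have h1 : Measurable fun ω => ξ ω i j := by fun_prop
  exact (hh.continuous j).measurable.comp (measurable_const.sub (Real.measurable_log.comp h1))

/-- By convexity of exp: a concave function of t vanishing at 0 has decreasing quotient by t. -/
theorem one_sub_exp_neg_mul_le {t u y : ℝ} (ht : 0 < t) (htu : t ≤ u) :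
    t * (1 - Real.exp (-(u * y))) ≤ u * (1 - Real.exp (-(t * y))) := by
  have hu : 0 < u := ht.trans_le htu
  have h := convexOn_exp.2 (mem_univ (-(u * y))) (mem_univ 0)
    (div_nonneg ht.le hu.le) (sub_nonneg.2 ((div_le_one hu).2 htu)) (add_sub_cancel (t / u) 1)
  have e : (t / u) • (-(u * y)) + (1 - t / u) • (0 : ℝ) = -(t * y) := by
    simp only [smul_eq_mul]
    field_simp
    ring
  rw [e] at h
  simp only [smul_eq_mul, Real.exp_zero, mul_one] at h
  have h2 := mul_le_mul_of_nonneg_left h hu.le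
  have e2 : u * (t / u * Real.exp (-(u * y)) + (1 - t / u)) =
      t * Real.exp (-(u * y)) + u - t := by
    field_simp
    ring
  rw [e2] at h2
  linarith

/-- The function `t ↦ 1 - 𝔼 exp (-t * |Z|)` in logarithmic scale. -/
noncomputable def logLaplace (Q : Measure Ω) (Z : Ω → ℝ) (x : ℝ) : ℝ :=
  ∫ ω, (1 - Real.exp (-(Real.exp (-x) * |Z ω|))) ∂Q

theorem one_sub_exp_mem_Icc (x z : ℝ) :
    1 - Real.exp (-(Real.exp (-x) * |z|)) ∈ Icc (0 : ℝ) 1 := by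
  have h1 : Real.exp (-(Real.exp (-x) * |z|)) ≤ 1 :=
    Real.exp_le_one_iff.2 (neg_nonpos.2 (by positivity))
  have h2 := Real.exp_pos (-(Real.exp (-x) * |z|))
  exact ⟨by linarith, by linarith⟩

variable {Q : Measure Ω} [IsProbabilityMeasure Q] {Z : Ω → ℝ}

theorem integrable_exp_neg (hZ : Measurable Z) (x : ℝ) :
    Integrable (fun ω => Real.exp (-(Real.exp (-x) * |Z ω|))) Q := by
  refine Integrable.of_bound (by fun_prop) 1 (ae_of_all _ fun ω => ?_)
  rw [Real.norm_of_nonneg (Real.exp_pos _).le]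
  linarith [(one_sub_exp_mem_Icc x (Z ω)).1]

theorem integrable_one_sub_exp (hZ : Measurable Z) (x : ℝ) :
    Integrable (fun ω => 1 - Real.exp (-(Real.exp (-x) * |Z ω|))) Q :=
  (integrable_const 1).sub (integrable_exp_neg hZ x)

theorem one_sub_logLaplace (hZ : Measurable Z) (x : ℝ) :
    1 - logLaplace Q Z x = ∫ ω, Real.exp (-(Real.exp (-x) * |Z ω|)) ∂Q := by
  rw [logLaplace, integral_sub (integrable_const 1) (integrable_exp_neg hZ x)]
  simp

theorem continuous_logLaplace (hZ : Measurable Z) : Continuous (logLaplace Q Z) := by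
  refine continuous_of_dominated (bound := fun _ => 1)
    (fun x => (integrable_one_sub_exp hZ x).aestronglyMeasurable)
    (fun x => ae_of_all _ fun ω => ?_) (integrable_const 1) (ae_of_all _ fun ω => by fun_prop)
  have := one_sub_exp_mem_Icc x (Z ω)
  rw [Real.norm_of_nonneg this.1]
  exact this.2

theorem tendsto_logLaplace (hZ : Measurable Z) : Tendsto (logLaplace Q Z) atTop (𝓝 0) := by
  rw [← integral_zero Ω ℝ (μ := Q)]
  refine tendsto_integral_filter_of_dominated_convergence (fun _ => 1)
    (Eventually.of_forall fun x => (integrable_one_sub_exp hZ x).aestronglyMeasurable)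
    (Eventually.of_forall fun x => ae_of_all _ fun ω => ?_) (integrable_const 1)
    (ae_of_all _ fun ω => ?_)
  · have := one_sub_exp_mem_Icc x (Z ω)
    rw [Real.norm_of_nonneg this.1]
    exact this.2
  · have h1 : Tendsto (fun x : ℝ => Real.exp (-x)) atTop (𝓝 0) := Real.tendsto_exp_neg_atTop_nhds_zero
    have h2 := (Real.continuous_exp.tendsto _).comp (h1.mul_const |Z ω|).neg
    have h3 := h2.const_sub 1
    simpa using h3

theorem antitone_logLaplace (hZ : Measurable Z) : Antitone (logLaplace Q Z) := by
  intro x y hxy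
  refine integral_mono (integrable_one_sub_exp hZ y) (integrable_one_sub_exp hZ x) fun ω => ?_
  dsimp only
  gcongr

theorem monotone_logLaplace_mul_exp (hZ : Measurable Z) :
    Monotone fun x => logLaplace Q Z x * Real.exp x := by
  intro x y hxy
  simp only [logLaplace]
  rw [← integral_mul_const, ← integral_mul_const]
  refine integral_mono ((integrable_one_sub_exp hZ x).mul_const _)
    ((integrable_one_sub_exp hZ y).mul_const _) fun ω => ?_
  have h := one_sub_exp_neg_mul_le (y := |Z ω|) (Real.exp_pos (-y))
    (Real.exp_le_exp.2 (neg_le_neg hxy))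
  dsimp only
  have h2 := mul_le_mul_of_nonneg_left h
    (mul_nonneg (Real.exp_pos x).le (Real.exp_pos y).le)
  have e1 : Real.exp x * Real.exp (-x) = 1 := by rw [← Real.exp_add]; simp
  have e2 : Real.exp y * Real.exp (-y) = 1 := by rw [← Real.exp_add]; simp
  calc (1 - Real.exp (-(Real.exp (-x) * |Z ω|))) * Real.exp x
      = Real.exp x * Real.exp y *
        (Real.exp (-y) * (1 - Real.exp (-(Real.exp (-x) * |Z ω|)))) := by
        linear_combination (-(1 - Real.exp (-(Real.exp (-x) * |Z ω|))) * Real.exp x) * e2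
    _ ≤ _ := h2
    _ = _ := by linear_combination ((1 - Real.exp (-(Real.exp (-y) * |Z ω|))) * Real.exp y) * e1

theorem logLaplace_pos (hZ : Measurable Z) (h1 : ∀ᵐ ω ∂Q, 1 ≤ Z ω) (x : ℝ) :
    0 < logLaplace Q Z x := by
  have h : ∫ _, (1 - Real.exp (-Real.exp (-x))) ∂Q ≤ logLaplace Q Z x := by
    refine integral_mono_ae (integrable_const _) (integrable_one_sub_exp hZ x) ?_
    filter_upwards [h1] with ω hω
    have h2 : Real.exp (-x) ≤ Real.exp (-x) * |Z ω| :=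
      le_mul_of_one_le_right (Real.exp_pos _).le (hω.trans (le_abs_self _))
    gcongr
  refine lt_of_lt_of_le ?_ h
  rw [integral_const]
  simp [Real.exp_pos]

theorem logLaplace_le_one (hZ : Measurable Z) (x : ℝ) : logLaplace Q Z x ≤ 1 := by
  have : 0 ≤ 1 - logLaplace Q Z x := by
    rw [one_sub_logLaplace hZ]
    exact integral_nonneg fun ω => (Real.exp_pos _).le
  linarith

end Profile

/-! ### From a solution to a Laplace profile -/

section Solution

variable {Ω : Type*} [MeasurableSpace Ω] {b : ℕ} {P : Measure Ω}
  {ξ : Ω → Fin b → Fin b → ℝ} {Ω' : Type*} [MeasurableSpace Ω'] {Q : Measure Ω'}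
  {X : Ω' → Fin b → Fin b → ℝ} {Y : Ω' → Fin b → ℝ}

theorem IsRDESolution.ae_pos (hY : IsRDESolution P ξ Q X Y)
    (hpos : ∀ i j, ∀ᵐ ω ∂P, 0 < ξ ω i j) (i j : Fin b) : ∀ᵐ ω ∂Q, 0 < X ω i j :=
  hY.identDistrib_matrix.symm.ae_snd (p := fun a => 0 < a i j)
    (measurableSet_lt measurable_const (by fun_prop)) (hpos i j)

theorem IsRDESolution.ae_one_le (hY : IsRDESolution P ξ Q X Y)
    (hpos : ∀ i j, ∀ᵐ ω ∂P, 0 < ξ ω i j) (i : Fin b) : ∀ᵐ ω ∂Q, 1 ≤ Y ω i := by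
  refine (hY.equation i).ae_snd (p := fun a => 1 ≤ a) measurableSet_Ici ?_
  filter_upwards [ae_all_iff.2 (hY.ae_pos hpos i), ae_all_iff.2 hY.nonneg] with ω h1 h2
  exact le_add_of_nonneg_right (Finset.sum_nonneg fun j _ => mul_nonneg (h1 j).le (h2 j))

/-- Conditionally on the matrix, independence of the components factors the Laplace transform; a
positive weight shifts the logarithmic variable by its logarithm. -/
theorem IsRDESolution.integral_exp (hY : IsRDESolution P ξ Q X Y)
    (hpos : ∀ i j, ∀ᵐ ω ∂P, 0 < ξ ω i j) (i : Fin b) (x : ℝ) :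
    ∫ ω, Real.exp (-(Real.exp (-x) * ∑ j, |X ω i j| * |Y ω j|)) ∂Q =
      ∫ ω, ∏ j, (1 - logLaplace Q (fun ω' => Y ω' j) (x - Real.log (ξ ω i j))) ∂P := by
  have := hY.isProbabilityMeasure
  have hX := hY.measurable_matrix
  have hYm := hY.measurable_vector
  have hYi : ∀ j, Measurable fun ω => Y ω j := fun j => by fun_prop
  have hνp : ∀ j, IsProbabilityMeasure (Q.map fun ω => Y ω j) := fun j =>
    Measure.isProbabilityMeasure_map (hYi j).aemeasurable
  have hXp : IsProbabilityMeasure (Q.map X) := Measure.isProbabilityMeasure_map hX.aemeasurable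
  have hlaw : Q.map (fun ω => (X ω, Y ω)) =
      (Q.map X).prod (Measure.pi fun j => Q.map fun ω => Y ω j) := by
    rw [(indepFun_iff_map_prod_eq_prod_map_map hX.aemeasurable hYm.aemeasurable).1
      hY.indep_matrix.symm, ← (iIndepFun_iff_map_fun_eq_pi_map
        fun j => (hYi j).aemeasurable).1 hY.indep_components]
  set f : (Fin b → Fin b → ℝ) × (Fin b → ℝ) → ℝ := fun z =>
    Real.exp (-(Real.exp (-x) * ∑ j, |z.1 i j| * |z.2 j|)) with hf
  have hfm : Measurable f := by fun_prop
  have hfint : Integrable f ((Q.map X).prod (Measure.pi fun j => Q.map fun ω => Y ω j)) := by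
    refine Integrable.of_bound hfm.aestronglyMeasurable 1 (ae_of_all _ fun z => ?_)
    rw [Real.norm_of_nonneg (Real.exp_pos _).le, Real.exp_le_one_iff, neg_nonpos]
    exact mul_nonneg (Real.exp_pos _).le
      (Finset.sum_nonneg fun j _ => mul_nonneg (abs_nonneg _) (abs_nonneg _))
  have hinner : ∀ a : Fin b → Fin b → ℝ, (∀ j, 0 < a i j) →
      ∫ y, f (a, y) ∂(Measure.pi fun j => Q.map fun ω => Y ω j) =
        ∏ j, (1 - logLaplace Q (fun ω' => Y ω' j) (x - Real.log (a i j))) := by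
    intro a ha
    have e : ∀ y : Fin b → ℝ, f (a, y) =
        ∏ j, Real.exp (-(Real.exp (-(x - Real.log (a i j))) * |y j|)) := by
      intro y
      rw [← Real.exp_sum, hf]
      simp only
      congr 1
      rw [Finset.sum_neg_distrib, Finset.mul_sum]
      congr 1
      refine Finset.sum_congr rfl fun j _ => ?_
      rw [neg_sub, sub_eq_neg_add, Real.exp_add, Real.exp_log (ha j), abs_of_pos (ha j), mul_assoc]
    simp only [e]
    rw [integral_fintype_prod_eq_prod
      (fun j (y : ℝ) => Real.exp (-(Real.exp (-(x - Real.log (a i j))) * |y|)))]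
    refine Finset.prod_congr rfl fun j _ => ?_
    rw [one_sub_logLaplace (hYi j), integral_map (hYi j).aemeasurable (by fun_prop)]
  have hsm : Measurable fun a : Fin b → Fin b → ℝ =>
      ∏ j, (1 - logLaplace Q (fun ω' => Y ω' j) (x - Real.log (a i j))) := by
    refine Finset.measurable_prod _ fun j _ => measurable_const.sub ?_
    refine (continuous_logLaplace (hYi j)).measurable.comp (measurable_const.sub ?_)
    exact Real.measurable_log.comp (by fun_prop)
  calc ∫ ω, f (X ω, Y ω) ∂Q
      = ∫ z, f z ∂(Q.map fun ω => (X ω, Y ω)) :=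
        (integral_map (hX.prodMk hYm).aemeasurable hfm.aestronglyMeasurable).symm
    _ = ∫ a, ∫ y, f (a, y) ∂(Measure.pi fun j => Q.map fun ω => Y ω j) ∂(Q.map X) := by
        rw [hlaw, integral_prod f hfint]
    _ = ∫ a, ∏ j, (1 - logLaplace Q (fun ω' => Y ω' j) (x - Real.log (a i j))) ∂(Q.map X) := by
        refine integral_congr_ae ?_
        have h : ∀ᵐ a ∂(Q.map X), ∀ j, 0 < a i j := by
          refine ae_all_iff.2 fun j => (ae_map_iff hX.aemeasurable ?_).2 (hY.ae_pos hpos i j)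
          exact measurableSet_lt measurable_const (by fun_prop)
        filter_upwards [h] with a ha
        exact hinner a ha
    _ = ∫ ω, ∏ j, (1 - logLaplace Q (fun ω' => Y ω' j) (x - Real.log (ξ ω i j))) ∂P := by
        rw [hY.identDistrib_matrix.map_eq,
          integral_map hY.identDistrib_matrix.aemeasurable_snd hsm.aestronglyMeasurable]

/-- The supersolution inequality comes from discarding the summand 1 in the equation; that summand
has already served to give Y ≥ 1, hence positivity. -/
theorem IsRDESolution.isLaplaceProfile (hY : IsRDESolution P ξ Q X Y)
    (hpos : ∀ i j, ∀ᵐ ω ∂P, 0 < ξ ω i j) :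
    IsLaplaceProfile P ξ fun i => logLaplace Q fun ω => Y ω i := by
  have := hY.isProbabilityMeasure
  have hX := hY.measurable_matrix
  have hYm := hY.measurable_vector
  have hYi : ∀ j, Measurable fun ω => Y ω j := fun j => by fun_prop
  refine ⟨fun i => continuous_logLaplace (hYi i),
    fun i => logLaplace_pos (hYi i) (hY.ae_one_le hpos i), fun i => logLaplace_le_one (hYi i),
    fun i => antitone_logLaplace (hYi i), fun i => monotone_logLaplace_mul_exp (hYi i),
    fun i => tendsto_logLaplace (hYi i), fun i x => ?_⟩
  rw [← hY.integral_exp hpos, sub_le_comm, one_sub_logLaplace (hYi i)]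
  have hg : Measurable fun y : ℝ => Real.exp (-(Real.exp (-x) * |y|)) := by fun_prop
  have e := ((hY.equation i).comp hg).integral_eq
  simp only [Function.comp_def] at e
  rw [← e]
  refine integral_mono_ae ?_ ?_ ?_
  · exact integrable_exp_neg (Z := fun ω => 1 + ∑ j, X ω i j * Y ω j) (by fun_prop) x
  · have h := integrable_exp_neg (Q := Q) (Z := fun ω => ∑ j, |X ω i j| * |Y ω j|)
      (by fun_prop) x
    refine h.congr (ae_of_all _ fun ω => ?_)
    simp only
    rw [abs_of_nonneg (Finset.sum_nonneg fun j _ => mul_nonneg (abs_nonneg _) (abs_nonneg _))]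
  · filter_upwards [ae_all_iff.2 (hY.ae_pos hpos i), ae_all_iff.2 hY.nonneg] with ω h1 h2
    have hs : ∑ j, |X ω i j| * |Y ω j| = ∑ j, X ω i j * Y ω j :=
      Finset.sum_congr rfl fun j _ => by rw [abs_of_pos (h1 j), abs_of_nonneg (h2 j)]
    have h0 : 0 ≤ ∑ j, X ω i j * Y ω j :=
      Finset.sum_nonneg fun j _ => mul_nonneg (h1 j).le (h2 j)
    rw [hs, abs_of_nonneg (by linarith)]
    gcongr
    linarith

end Solution

/-! ### Comparison with a slowly curving test function -/

section MaximumPrinciple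

open Filter Topology

/-- The slope of the test function: the projection onto `[0, 1]`. -/
noncomputable def slope (u : ℝ) : ℝ := max u 0 - max (u - 1) 0

/-- The primitive of `slope` which vanishes on `(-∞, 0]`. -/
noncomputable def slopePrimitive (u : ℝ) : ℝ := (max u 0 ^ 2 - max (u - 1) 0 ^ 2) / 2

theorem slope_mem_Icc (u : ℝ) : slope u ∈ Icc (0 : ℝ) 1 := by
  unfold slope
  rcases max_cases u 0 with ⟨h, _⟩ | ⟨h, _⟩ <;> rcases max_cases (u - 1) 0 with ⟨h', _⟩ | ⟨h', _⟩ <;>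
    rw [h, h'] <;> constructor <;> linarith

theorem slope_of_nonpos {u : ℝ} (hu : u ≤ 0) : slope u = 0 := by
  rw [slope, max_eq_right hu, max_eq_right (by linarith), sub_zero]

theorem slope_of_one_le {u : ℝ} (hu : 1 ≤ u) : slope u = 1 := by
  rw [slope, max_eq_left (by linarith), max_eq_left (by linarith)]
  ring

theorem slopePrimitive_of_nonpos {u : ℝ} (hu : u ≤ 0) : slopePrimitive u = 0 := by
  rw [slopePrimitive, max_eq_right hu, max_eq_right (by linarith)]
  ring

theorem slopePrimitive_of_one_le {u : ℝ} (hu : 1 ≤ u) : slopePrimitive u = u - 1 / 2 := by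
  rw [slopePrimitive, max_eq_left (by linarith), max_eq_left (by linarith)]
  ring

theorem abs_slope_sub_le (u w : ℝ) : |slope u - slope w| ≤ |u - w| := by
  unfold slope
  rcases max_cases u 0 with ⟨h, _⟩ | ⟨h, _⟩ <;>
    rcases max_cases (u - 1) 0 with ⟨h', _⟩ | ⟨h', _⟩ <;>
    rcases max_cases w 0 with ⟨k, _⟩ | ⟨k, _⟩ <;>
    rcases max_cases (w - 1) 0 with ⟨k', _⟩ | ⟨k', _⟩ <;>
    rw [h, h', k, k', abs_le] <;>
    constructor <;> linarith [le_abs_self (u - w), neg_abs_le (u - w)]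

/-- A second-order Taylor bound: the derivative `slope` is 1-Lipschitz. -/
theorem slopePrimitive_add_le (u w : ℝ) :
    slopePrimitive (u + w) ≤ slopePrimitive u + slope u * w + w ^ 2 / 2 := by
  have h1 : max (u + w) 0 ^ 2 ≤ max u 0 ^ 2 + 2 * (max u 0 * w) + w ^ 2 := by
    rcases max_cases u 0 with ⟨h, _⟩ | ⟨h, _⟩ <;>
      rcases max_cases (u + w) 0 with ⟨k, _⟩ | ⟨k, _⟩ <;> rw [h, k] <;>
      nlinarith [sq_nonneg (u + w), sq_nonneg w]
  have h2 : max (u - 1) 0 ^ 2 + 2 * (max (u - 1) 0 * w) ≤ max (u + w - 1) 0 ^ 2 := by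
    rcases max_cases (u - 1) 0 with ⟨h, _⟩ | ⟨h, _⟩ <;>
      rcases max_cases (u + w - 1) 0 with ⟨k, _⟩ | ⟨k, _⟩ <;> rw [h, k] <;>
      nlinarith [sq_nonneg (u + w - 1), sq_nonneg w]
  unfold slopePrimitive slope
  linarith

theorem continuous_slope : Continuous slope := by
  unfold slope
  fun_prop

theorem continuous_slopePrimitive : Continuous slopePrimitive := by
  unfold slopePrimitive
  fun_prop

/-- The test function which starts at `A` and has slopes varying from `0` to `-1` over an interval
of length `R`. -/
noncomputable def testFun {ι : Type*} (v : ℝ → ι → ℝ) (A R : ℝ) (i : ι) (x : ℝ) : ℝ :=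
  v (slope ((x - A) / R)) i * Real.exp (-(R * slopePrimitive ((x - A) / R)))

theorem continuous_testFun {ι : Type*} {v : ℝ → ι → ℝ} (hv : ContinuousOn v (Icc 0 1)) (A R : ℝ)
    (i : ι) : Continuous (testFun v A R i) := by
  have h1 : Continuous fun x : ℝ => (x - A) / R := by fun_prop
  have h2 := (continuousOn_pi.1 hv i).comp_continuous (continuous_slope.comp h1)
    fun x => slope_mem_Icc _
  have h3 := continuous_slopePrimitive.comp h1
  exact h2.mul (Real.continuous_exp.comp (continuous_const.mul h3).neg)

/-- On shifts of size at most K the test function is nearly exponential with rate `slope`. One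
factor 1 - κ pays for the variation of v, the other for the curvature term K² / (2R). -/
theorem testFun_sub_ge {ι : Type*} {v : ℝ → ι → ℝ} {A R κ K : ℝ} (hR : 0 < R) (hκ1 : κ ≤ 1)
    (hv0 : ∀ s ∈ Icc (0 : ℝ) 1, ∀ i, 0 ≤ v s i)
    (hvκ : ∀ s ∈ Icc (0 : ℝ) 1, ∀ s' ∈ Icc (0 : ℝ) 1, |s' - s| ≤ K / R →
      ∀ i, (1 - κ) * v s i ≤ v s' i)
    (hexp : 1 - κ ≤ Real.exp (-(K ^ 2 / (2 * R)))) (i : ι) (x : ℝ) {y : ℝ} (hy : |y| ≤ K) :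
    (1 - κ) ^ 2 * Real.exp (-(R * slopePrimitive ((x - A) / R))) *
      (Real.exp (slope ((x - A) / R) * y) * v (slope ((x - A) / R)) i) ≤
      testFun v A R i (x - y) := by
  set u := (x - A) / R with hu
  have e : (x - y - A) / R = u + -(y / R) := by rw [hu]; ring
  have h1 : |slope (u + -(y / R)) - slope u| ≤ K / R := by
    refine (abs_slope_sub_le _ _).trans ?_
    rw [add_sub_cancel_left, abs_neg, abs_div, abs_of_pos hR]
    gcongr
  have h2 := hvκ _ (slope_mem_Icc u) _ (slope_mem_Icc (u + -(y / R))) h1 i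
  have h3 := slopePrimitive_add_le u (-(y / R))
  have hy2 : y ^ 2 ≤ K ^ 2 := sq_le_sq' (neg_le_of_abs_le hy) (le_of_abs_le hy)
  have h4 : -(R * slopePrimitive u) + slope u * y + -(K ^ 2 / (2 * R)) ≤
      -(R * slopePrimitive (u + -(y / R))) := by
    have h5 := mul_le_mul_of_nonneg_left h3 hR.le
    have h6 : R * (slopePrimitive u + slope u * -(y / R) + (-(y / R)) ^ 2 / 2) =
        R * slopePrimitive u - slope u * y + y ^ 2 / (2 * R) := by
      field_simp
      ring
    have h7 : y ^ 2 / (2 * R) ≤ K ^ 2 / (2 * R) := by gcongr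
    linarith
  have h5 := Real.exp_le_exp.2 h4
  rw [Real.exp_add, Real.exp_add] at h5
  have hκ0 : 0 ≤ 1 - κ := by linarith
  rw [testFun, e]
  calc (1 - κ) ^ 2 * Real.exp (-(R * slopePrimitive u)) * (Real.exp (slope u * y) * v (slope u) i)
      = ((1 - κ) * v (slope u) i) *
        (Real.exp (-(R * slopePrimitive u)) * Real.exp (slope u * y) * (1 - κ)) := by ring
    _ ≤ v (slope (u + -(y / R))) i * (Real.exp (-(R * slopePrimitive u)) *
          Real.exp (slope u * y) * Real.exp (-(K ^ 2 / (2 * R)))) := by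
        have := hv0 _ (slope_mem_Icc (u + -(y / R))) i
        gcongr
    _ ≤ _ := mul_le_mul_of_nonneg_left h5 (hv0 _ (slope_mem_Icc _) i)

/-- A positive function whose slopes lie between `0` and `-1` is touched from below by a multiple
of the test function at a point where the test function is curved. -/
theorem exists_touching {ι : Type*} [Finite ι] [Nonempty ι] {v : ℝ → ι → ℝ}
    (hv : ContinuousOn v (Icc 0 1)) {h : ι → ℝ → ℝ} (hc : ∀ i, Continuous (h i))
    (hpos : ∀ i x, 0 < h i x) (hanti : ∀ i, Antitone (h i))
    (hmono : ∀ i, Monotone fun x => h i x * Real.exp x)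
    (hv0 : ∀ s ∈ Icc (0 : ℝ) 1, ∀ i, 0 < v s i) (A : ℝ) {R : ℝ} (hR : 0 < R) :
    ∃ C > 0, ∃ i, ∃ x ∈ Icc A (A + R), testFun v A R i x = C * h i x ∧
      ∀ j y, testFun v A R j y ≤ C * h j y := by
  -- It suffices to maximize the ratio to h on this interval. To its left the test function is
  -- constant while h only grows; to its right it is a multiple of e^(-y), while h(y) e^y only
  -- grows.
  have hloc : ∀ i, ∃ x ∈ Icc A (A + R), ∀ y ∈ Icc A (A + R),
      testFun v A R i y / h i y ≤ testFun v A R i x / h i x := fun i =>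
    isCompact_Icc.exists_isMaxOn (nonempty_Icc.2 (by linarith))
      ((continuous_testFun hv A R i).div (hc i) fun x => (hpos i x).ne').continuousOn
  choose x hx hmax using hloc
  obtain ⟨i, hi⟩ := Finite.exists_max fun i => testFun v A R i (x i) / h i (x i)
  have hCpos : 0 < testFun v A R i (x i) / h i (x i) :=
    div_pos (mul_pos (hv0 _ (slope_mem_Icc _) i) (Real.exp_pos _)) (hpos i _)
  set C := testFun v A R i (x i) / h i (x i) with hC
  have hin : ∀ j, ∀ y ∈ Icc A (A + R), testFun v A R j y ≤ C * h j y := fun j y hy =>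
    (div_le_iff₀ (hpos j y)).1 ((hmax j y hy).trans (hi j))
  refine ⟨C, hCpos, i, x i, hx i, (div_mul_cancel₀ _ (hpos i _).ne').symm, fun j y => ?_⟩
  rcases le_total y A with hy | hy
  · have e : testFun v A R j y = testFun v A R j A := by
      have h1 : (y - A) / R ≤ 0 := div_nonpos_of_nonpos_of_nonneg (by linarith) hR.le
      have h2 : (A - A) / R ≤ 0 := by simp
      rw [testFun, testFun, slope_of_nonpos h1, slope_of_nonpos h2, slopePrimitive_of_nonpos h1,
        slopePrimitive_of_nonpos h2]
    rw [e]
    exact (hin j A (left_mem_Icc.2 (by linarith))).trans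
      (mul_le_mul_of_nonneg_left (hanti j hy) hCpos.le)
  rcases le_total y (A + R) with hy' | hy'
  · exact hin j y ⟨hy, hy'⟩
  · have e : testFun v A R j y * Real.exp y = testFun v A R j (A + R) * Real.exp (A + R) := by
      have h1 : 1 ≤ (y - A) / R := (one_le_div hR).2 (by linarith)
      have h2 : 1 ≤ (A + R - A) / R := (one_le_div hR).2 (by linarith)
      rw [testFun, testFun, slope_of_one_le h1, slope_of_one_le h2, slopePrimitive_of_one_le h1,
        slopePrimitive_of_one_le h2, mul_assoc, mul_assoc, ← Real.exp_add, ← Real.exp_add]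
      congr 2
      field_simp
      ring
    refine le_of_mul_le_mul_right ?_ (Real.exp_pos y)
    rw [e]
    calc testFun v A R j (A + R) * Real.exp (A + R)
        ≤ C * h j (A + R) * Real.exp (A + R) :=
          mul_le_mul_of_nonneg_right (hin j _ (right_mem_Icc.2 (by linarith))) (Real.exp_pos _).le
      _ = C * (h j (A + R) * Real.exp (A + R)) := mul_assoc _ _ _
      _ ≤ C * (h j y * Real.exp y) := mul_le_mul_of_nonneg_left (hmono j hy') hCpos.le
      _ = C * h j y * Real.exp y := (mul_assoc _ _ _).symm

/-- With S = ∑ a, the product is at most e^(-S), and S ≤ (1 + S)(1 - e^(-S)) because e^S ≥ 1 + S. -/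
theorem sum_le_mul_one_sub_prod {ι : Type*} (t : Finset ι) {a c : ι → ℝ} {δ : ℝ}
    (ha0 : ∀ j ∈ t, 0 ≤ a j) (hac : ∀ j ∈ t, a j ≤ c j) (hc : ∀ j ∈ t, c j ≤ 1)
    (hδ : ∑ j ∈ t, a j ≤ δ) :
    ∑ j ∈ t, a j ≤ (1 + δ) * (1 - ∏ j ∈ t, (1 - c j)) := by
  set S := ∑ j ∈ t, a j with hS
  have hS0 : 0 ≤ S := Finset.sum_nonneg ha0
  have h1 : ∏ j ∈ t, (1 - c j) ≤ Real.exp (-S) := by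
    rw [hS, ← Finset.sum_neg_distrib, Real.exp_sum]
    refine Finset.prod_le_prod (fun j hj => sub_nonneg.2 (hc j hj)) fun j hj => ?_
    linarith [hac j hj, Real.add_one_le_exp (-a j)]
  have h2 : Real.exp (-S) * (1 + S) ≤ 1 := by
    have h3 := Real.add_one_le_exp S
    have h4 : Real.exp (-S) * Real.exp S = 1 := by rw [← Real.exp_add]; simp
    have h5 := mul_le_mul_of_nonneg_left h3 (Real.exp_pos (-S)).le
    linarith
  have h6 : Real.exp (-S) ≤ 1 := Real.exp_le_one_iff.2 (neg_nonpos.2 hS0)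
  have h7 : S ≤ (1 + S) * (1 - Real.exp (-S)) := by linarith
  have h8 : (1 + S) * (1 - Real.exp (-S)) ≤ (1 + δ) * (1 - Real.exp (-S)) :=
    mul_le_mul_of_nonneg_right (by linarith) (by linarith)
  have h9 : (1 + δ) * (1 - Real.exp (-S)) ≤ (1 + δ) * (1 - ∏ j ∈ t, (1 - c j)) :=
    mul_le_mul_of_nonneg_left (by linarith) (by linarith)
  linarith

variable {Ω : Type*} [MeasurableSpace Ω] {b : ℕ} {P : Measure Ω} [IsProbabilityMeasure P]
  {ξ : Ω → Fin b → Fin b → ℝ} {h : Fin b → ℝ → ℝ}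

theorem IsLaplaceProfile.integrable_indicator (hh : IsLaplaceProfile P ξ h) (hξ : Measurable ξ)
    (K : ℝ) (i j : Fin b) (x : ℝ) : Integrable ({ω | |Real.log (ξ ω i j)| ≤ K}.indicator
      fun ω => h j (x - Real.log (ξ ω i j))) P := by
  refine Integrable.indicator ?_ (measurableSet_abs_log_le hξ K i j)
  refine Integrable.of_bound (hh.measurable_comp hξ i j x).aestronglyMeasurable 1
    (ae_of_all _ fun ω => ?_)
  rw [Real.norm_of_nonneg (hh.pos j _).le]
  exact hh.le_one j _

/-- Far out, a Laplace profile is almost a supersolution of the linearized equation. -/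
theorem IsLaplaceProfile.exists_linearized (hh : IsLaplaceProfile P ξ h) (hξ : Measurable ξ)
    (K : ℝ) {δ : ℝ} (hδ : 0 < δ) :
    ∃ A, ∀ x ≥ A, ∀ i, ∑ j, ∫ ω, {ω | |Real.log (ξ ω i j)| ≤ K}.indicator
      (fun ω => h j (x - Real.log (ξ ω i j))) ω ∂P ≤ (1 + δ) * h i x := by
  have hev : ∀ᶠ x in atTop, ∀ j, h j x ≤ δ / (b + 1) :=
    eventually_all.2 fun j => ((hh.tendsto_zero j).eventually_lt_const (by positivity)).mono
      fun x hx => hx.le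
  obtain ⟨A, hA⟩ := eventually_atTop.1 hev
  -- On the truncation event the shift is at most K, so every argument of h stays beyond A, where h
  -- is small.
  refine ⟨A + K, fun x hx i => ?_⟩
  rw [← integral_finsetSum _ fun j _ => hh.integrable_indicator hξ K i j x]
  have hprod : Integrable (fun ω => ∏ j, (1 - h j (x - Real.log (ξ ω i j)))) P := by
    refine Integrable.of_bound (Finset.measurable_fun_prod _ fun j _ =>
      (measurable_const.sub (hh.measurable_comp hξ i j x))).aestronglyMeasurable 1
      (ae_of_all _ fun ω => ?_)
    have h0 : ∀ j ∈ Finset.univ, 0 ≤ 1 - h j (x - Real.log (ξ ω i j)) := fun j _ =>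
      sub_nonneg.2 (hh.le_one j _)
    rw [Real.norm_of_nonneg (Finset.prod_nonneg h0)]
    exact Finset.prod_le_one h0 fun j _ => by linarith [hh.pos j (x - Real.log (ξ ω i j))]
  refine le_trans ?_ (mul_le_mul_of_nonneg_left (hh.supersolution i x) (by linarith))
  have e : (1 + δ) * (1 - ∫ ω, ∏ j, (1 - h j (x - Real.log (ξ ω i j))) ∂P) =
      ∫ ω, (1 + δ) * (1 - ∏ j, (1 - h j (x - Real.log (ξ ω i j)))) ∂P := by
    rw [integral_const_mul, integral_sub (integrable_const 1) hprod]
    simp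
  rw [e]
  refine integral_mono (integrable_finsetSum _ fun j _ => hh.integrable_indicator hξ K i j x)
    (((integrable_const 1).sub hprod).const_mul _) fun ω => ?_
  refine sum_le_mul_one_sub_prod _ (fun j _ => indicator_nonneg (fun ω _ => (hh.pos j _).le) ω)
    (fun j _ => indicator_le_self' (fun ω _ => (hh.pos j _).le) ω) (fun j _ => hh.le_one j _) ?_
  calc ∑ j, {ω | |Real.log (ξ ω i j)| ≤ K}.indicator (fun ω => h j (x - Real.log (ξ ω i j))) ω
      ≤ ∑ j : Fin b, δ / (b + 1) := by
        refine Finset.sum_le_sum fun j _ => ?_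
        refine indicator_apply_le' (fun hω => ?_) fun _ => by positivity
        refine hA _ ?_ j
        have : |Real.log (ξ ω i j)| ≤ K := hω
        linarith [le_of_abs_le this]
    _ = b * (δ / (b + 1)) := by simp
    _ ≤ δ := by
        rw [mul_div_assoc', div_le_iff₀ (by positivity)]
        nlinarith

theorem not_isLaplaceProfile (hb : 0 < b) (hξ : Measurable ξ)
    (hpos : ∀ i j, ∀ᵐ ω ∂P, 0 < ξ ω i j) (hD : Icc (0 : ℝ) 1 ⊆ momentDomain P ξ)
    (hl : 1 < lambda1 P ξ) : ¬ IsLaplaceProfile P ξ h := by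
  intro hh
  have : Nonempty (Fin b) := ⟨⟨0, hb⟩⟩
  obtain ⟨v, ε, K, hvc, hε, hε1, hK, hv1, hsub⟩ := exists_truncated_subsolution hb hξ hpos hD hl
  have hv0 : ∀ s ∈ Icc (0 : ℝ) 1, ∀ i, 0 < v s i := fun s hs i => one_pos.trans_le (hv1 s hs i)
  set κ := ε / 8 with hκ
  have hκ0 : 0 < κ := by positivity
  obtain ⟨A, hA⟩ := hh.exists_linearized hξ K hκ0
  obtain ⟨d, hd, hvd⟩ := Metric.uniformContinuousOn_iff.1
    (isCompact_Icc.uniformContinuousOn_of_continuous hvc) κ hκ0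
  -- The first term gives K / R < d, for the uniform continuity of v; the second gives K² / (2R) ≤
  -- κ, for the curvature.
  set R := (K + 1) / d + K ^ 2 / κ with hRdef
  have hR : 0 < R := by positivity
  have hKR : K / R < d := by
    rw [div_lt_iff₀ hR, hRdef, mul_add, mul_div_cancel₀ _ hd.ne']
    have : 0 ≤ d * (K ^ 2 / κ) := by positivity
    linarith
  have hvκ : ∀ s ∈ Icc (0 : ℝ) 1, ∀ s' ∈ Icc (0 : ℝ) 1, |s' - s| ≤ K / R →
      ∀ i, (1 - κ) * v s i ≤ v s' i := by
    intro s hs s' hs' hss i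
    have h1 := hvd s' hs' s hs (by rw [Real.dist_eq]; exact hss.trans_lt hKR)
    have h2 := (dist_le_pi_dist (v s') (v s) i).trans h1.le
    rw [Real.dist_eq] at h2
    have h3 := neg_le_of_abs_le h2
    have h4 := mul_le_mul_of_nonneg_left (hv1 s hs i) hκ0.le
    linarith
  have hexp : 1 - κ ≤ Real.exp (-(K ^ 2 / (2 * R))) := by
    have h1 : K ^ 2 / (2 * R) ≤ κ := by
      rw [div_le_iff₀ (by positivity), hRdef]
      have h2 : κ * (2 * ((K + 1) / d + K ^ 2 / κ)) = 2 * κ * ((K + 1) / d) + 2 * K ^ 2 := by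
        field_simp
      have h3 : 0 ≤ 2 * κ * ((K + 1) / d) := by positivity
      rw [h2]
      nlinarith [sq_nonneg K]
    linarith [Real.add_one_le_exp (-(K ^ 2 / (2 * R)))]
  obtain ⟨C, hC, i, x, hx, htouch, hle⟩ := exists_touching hvc hh.continuous hh.pos hh.antitone
    hh.monotone_mul_exp hv0 A hR
  set u := (x - A) / R with hu
  set E := (1 - κ) ^ 2 * Real.exp (-(R * slopePrimitive u)) with hE
  have hE0 : 0 ≤ E := by positivity
  have hs := slope_mem_Icc u
  have h1 : E * ∑ j, truncMoment P ξ K (slope u) i j * v (slope u) j ≤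
      C * ∑ j, ∫ ω, {ω | |Real.log (ξ ω i j)| ≤ K}.indicator
        (fun ω => h j (x - Real.log (ξ ω i j))) ω ∂P := by
    rw [Finset.mul_sum, Finset.mul_sum]
    refine Finset.sum_le_sum fun j _ => ?_
    rw [truncMoment, ← integral_mul_const, ← integral_const_mul, ← integral_const_mul]
    refine integral_mono_ae ((((hD hs i j).indicator
      (measurableSet_abs_log_le hξ K i j)).mul_const _).const_mul _)
      ((hh.integrable_indicator hξ K i j x).const_mul _) ?_
    filter_upwards [hpos i j] with ω hω
    by_cases hmem : ω ∈ {ω | |Real.log (ξ ω i j)| ≤ K}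
    · rw [indicator_of_mem hmem, indicator_of_mem hmem]
      have h2 := testFun_sub_ge (A := A) hR (by linarith) (fun s hs i => (hv0 s hs i).le) hvκ hexp j x
        (y := Real.log (ξ ω i j)) hmem
      rw [Real.rpow_def_of_pos hω, mul_comm (Real.log _)]
      exact h2.trans (hle j _)
    · simp only [indicator_of_notMem hmem, zero_mul, mul_zero, le_refl]
  have h2 := mul_le_mul_of_nonneg_left (hA x hx.1 i) hC.le
  have h3 := mul_le_mul_of_nonneg_left (hsub _ hs i) hE0
  have h4 : C * ((1 + κ) * h i x) =
      (1 + κ) * (v (slope u) i * Real.exp (-(R * slopePrimitive u))) := by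
    rw [mul_left_comm, ← htouch, testFun]
  have h5 : 0 < v (slope u) i * Real.exp (-(R * slopePrimitive u)) :=
    mul_pos (hv0 _ hs i) (Real.exp_pos _)
  have h6 : (1 - κ) ^ 2 * (1 + ε) * (v (slope u) i * Real.exp (-(R * slopePrimitive u))) ≤
      (1 + κ) * (v (slope u) i * Real.exp (-(R * slopePrimitive u))) := by
    calc _ = E * ((1 + ε) * v (slope u) i) := by rw [hE]; ring
      _ ≤ _ := h3.trans (h1.trans (h2.trans h4.le))
  -- Now (1 - κ)² (1 + 8κ) ≤ 1 + κ, that is 5κ - 15κ² + 8κ³ ≤ 0, which fails for 0 < κ ≤ 1/8.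
  have h7 := le_of_mul_le_mul_right h6 h5
  have h8 : ε = 8 * κ := by rw [hκ]; ring
  rw [h8] at h7 hε1
  nlinarith [mul_pos hκ0 hκ0, mul_pos (mul_pos hκ0 hκ0) hκ0]

end MaximumPrinciple

end ColouredTree

/-! ### The dichotomy -/

theorem corollary2 {Ω : Type*} [MeasurableSpace Ω] (P : Measure Ω) [IsProbabilityMeasure P]
    (b : ℕ) (hb : 2 ≤ b) (ξ : Ω → Fin b → Fin b → ℝ) (hξ : Measurable ξ)
    (hpos : ∀ i j, ∀ᵐ ω ∂P, 0 < ξ ω i j) (hreg : ColouredTree.Regular P ξ) :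
    (ColouredTree.lambda1 P ξ < 1 →
      ∃ (Ω' : Type) (_ : MeasurableSpace Ω') (Q : Measure Ω')
        (X : Ω' → Fin b → Fin b → ℝ) (Y : Ω' → Fin b → ℝ),
        ColouredTree.IsRDESolution P ξ Q X Y) ∧
    (1 < ColouredTree.lambda1 P ξ →
      ¬ ∃ (Ω' : Type*) (_ : MeasurableSpace Ω') (Q : Measure Ω')
        (X : Ω' → Fin b → Fin b → ℝ) (Y : Ω' → Fin b → ℝ),
        ColouredTree.IsRDESolution P ξ Q X Y) := by
  refine ⟨ColouredTree.exists_isRDESolution_of_lambda1_lt_one hb hξ hpos hreg.unit_interval, ?_⟩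
  rintro hl ⟨Ω', _, Q, X, Y, hY⟩
  exact ColouredTree.not_isLaplaceProfile (by omega) hξ hpos hreg.unit_interval hl
    (hY.isLaplaceProfile hpos)
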